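/- **Conventions.** A Lévy process in $\mathbb R^m$ is a process $(X(t))_{t\ge 0}$ with $X(0)=0$ a.s., independent and stationary increments, and a.s. càdlàg paths. Write $X\sim L^m(\mu,\Sigma,\mathcal X)$ if it has characteristic triplet $(\mu,\Sigma,\mathcal X)$ (with $\mu\in\mathbb R^m$, $\Sigma$ a covariance matrix, $\mathcal X$ a Lévy measure on $\mathbb R^m\setminus\{0\}$), i.e. $\mathbb E e^{i\langle\theta,X(t)\rangle}=e^{t\Psi(\theta)}$ for all $t\ge0$, $\theta\in\mathbb R^m$, where $$\Psi(\theta)=i\langle\mu,\theta\rangle-\tfrac12\theta\Sigma\theta'+\int\big(e^{i\langle\theta,x\rangle}-1-i\langle\theta,x\rangle\mathbf 1_{\mathbb D}(x)\big)\,\mathcal X(dx)$$ and $\mathbb D$ is the closed Euclidean unit ball centred at the origin (of $\mathbb R^m$, for whichever $m$ is relevant). An $n$-dimensional subordinator $T$ is a Lévy process in $\mathbb R^n$ with nondecreasing components; write $T\sim S^n(d,\mathcal T)$ if its triplet is $(d+\int_{\mathbb D}t\,\mathcal T(dt),0,\mathcal T)$, where $d\in[0,\infty)^n$ is its drift and $\mathcal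 T$ is a measure on $[0,\infty)^n_*:=[0,\infty)^n\setminus\{0\}$ with $\int_{\mathbb D}\|t\|\,\mathcal T(dt)<\infty$; $T$ is drift-less if $d=0$. For $\mathbf t\in[0,\infty)^n$ put $X(\mathbf t):=(X_1(t_1),\dots,X_n(t_n))$, so that $X(T(t))=(X_1(T_1(t)),\dots,X_n(T_n(t)))$. For $\mathbf t\in[0,\infty)^n$ with ordered components $t_{(1)}\le\dots\le t_{(n)}$, set $t_{(0)}:=0$, $\Delta t_{(k)}:=t_{(k)}-t_{(k-1)}$, and let $\pi_k$ be the coordinate projection $\mathbb R^n\to\mathbb R^n$ that keeps the coordinates $(k),\dots,(n)$ and sets the others to $0$. Put $\mathbf t\diamond\mu:=(t_k\mu_k)_k$, $(\mathbf t\diamond\Sigma)_{kl}:=\Sigma_{kl}\min(t_k,t_l)$, $$\mathbf t\diamond\mathcal X:=\sum_{k=1}^n\Delta t_{(k)}\,(\mathcal X\circ\pi_k^{-1})|_{\mathbb R^n\setminus\{0\}},\qquad c(\mathbf t,\mathcal X):=\sum_{k=2}^n\Delta t_{(k)}\int_{\mathbb D^C}\pi_k(x)\mathbf 1_{\mathbb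 D}(\pi_k(x))\,\mathcal X(dx).$$ Given $T\sim S^n(d,\mathcal T)$ and $X\sim L^n(\mu,\Sigma,\mathcal X)$, a process $Z=(Z_1,Z_2)$, possibly on another probability space, is *$T$ subordinating $X$ in the weak sense*, written $Z\stackrel d=(T,X\odot T)$, if $Z\sim L^{2n}(m,\Theta,\mathcal Z)$ with $m=(m_1,m_2)$, $$m_1=d+\int_{[0,\infty)^n_*}\mathbf t\,\mathbb P\big((\mathbf t,X(\mathbf t))\in\mathbb D\big)\,\mathcal T(d\mathbf t),$$ $$m_2=c(d,\mathcal X)+d\diamond\mu+\int_{[0,\infty)^n_*}\mathbb E\big[X(\mathbf t)\mathbf 1_{\mathbb D}(\mathbf t,X(\mathbf t))\big]\,\mathcal T(d\mathbf t),$$ $$\Theta=\begin{pmatrix}0&0\\0&d\diamond\Sigma\end{pmatrix},\qquad \mathcal Z(d\mathbf t,dx)=\big(\delta_0\otimes(d\diamond\mathcal X)\big)(d\mathbf t,dx)+\mathbf 1_{[0,\infty)^n_*\times\mathbb R^n}(\mathbf t,x)\,\mathbb P(X(\mathbf t)\in dx)\,\mathcal T(d\mathbf t).$$ One writes $Y\stackrel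 d=X\odot T$ if $Y$ has the same law as the component $Z_2$ of such a $Z$. **Proposition.** Let $T=(T_1,T_2)$, $X=(X_1,X_2)$ and $Y=(Y_1,Y_2)$ be bivariate Lévy processes, where $T$ and $X$ are independent (and defined on one probability space), $T$ is a subordinator, and the components $X_1,X_2$ of $X$ are dependent processes; $Y$ may live on another probability space. Then there is at least one $t\in(0,\infty)$ for which $X(T(t))\stackrel d=Y(t)$ fails, provided one of the following holds in addition: (i) $T(1)$ and $X(1)$ have finite second moments, $\operatorname{Cov}(X_1(1),X_2(1))\ne0$, and $T$ has non-monotonic components, that is, neither $T_2-T_1$ nor $T_1-T_2$ is a subordinator; (ii) $Y\stackrel d=X\odot T$, $X$ is symmetric (the processes $X$ and $-X$ have the same law), and $T_1,T_2$ are independent, drift-less and nontrivial (neither $T_1$ nor $T_2$ is a.s. the null process). -/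

import Mathlib

open MeasureTheory ProbabilityTheory Filter Topology
open scoped NNReal ENNReal

noncomputable section

namespace WeakSubordination

/-! ### Lévy processes and subordinators -/

section Processes

variable {Ω : Type*} [MeasurableSpace Ω] {ι : Type*} [Fintype ι]

/-- Right-continuous paths with left limits (at time `0` the condition on the left is void). -/
def IsCadlag (x : ℝ≥0 → EuclideanSpace ℝ ι) : Prop :=
  ∀ t, ContinuousWithinAt x (Set.Ici t) t ∧ ∃ l, Tendsto x (𝓝[<] t) (𝓝 l)

/-- `X` is a Lévy process with values in `ℝ^ι` under the probability measure `P`. -/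
structure IsLevyProcess (P : Measure Ω) (X : ℝ≥0 → Ω → EuclideanSpace ℝ ι) : Prop where
  measurable : ∀ t, Measurable (X t)
  zero : ∀ᵐ ω ∂P, X 0 ω = 0
  indepIncrements : HasIndepIncrements X P
  stationaryIncrements :
    ∀ s t : ℝ≥0, IdentDistrib (fun ω => X (s + t) ω - X s ω) (X t) P P
  cadlag : ∀ᵐ ω ∂P, IsCadlag (fun t => X t ω)

/-- A (multivariate) subordinator: a Lévy process with nondecreasing components. -/
structure IsSubordinator (P : Measure Ω) (T : ℝ≥0 → Ω → EuclideanSpace ℝ ι) : Prop where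
  levy : IsLevyProcess P T
  monotone : ∀ᵐ ω ∂P, ∀ k, Monotone (fun t => T t ω k)

/-- A process as a random element of the path space with the product `σ`-algebra; its law is the
collection of the finite dimensional distributions. -/
def path {E : Type*} (X : ℝ≥0 → Ω → E) : Ω → ℝ≥0 → E := fun ω t => X t ω

/-- The `k`-th component of a process. -/
def component (X : ℝ≥0 → Ω → EuclideanSpace ℝ ι) (k : ι) : ℝ≥0 → Ω → ℝ := fun t ω => X t ω k

/-- A real-valued process as a process with values in `ℝ¹`. -/
def scalar (X : ℝ≥0 → Ω → ℝ) : ℝ≥0 → Ω → EuclideanSpace ℝ (Fin 1) := fun t ω => !₂[X t ω]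

/-- A bivariate subordinator `(T₁, T₂)` has monotonic components if `T₂ - T₁` or `T₁ - T₂` is a
subordinator. -/
def HasMonotonicComponents (P : Measure Ω) (T : ℝ≥0 → Ω → EuclideanSpace ℝ (Fin 2)) : Prop :=
  IsSubordinator P (scalar fun t ω => T t ω 1 - T t ω 0) ∨
    IsSubordinator P (scalar fun t ω => T t ω 0 - T t ω 1)

/-- `X(𝐭) = (X_k(t_k))_k` for a multivariate time `𝐭 ∈ [0,∞)^ι`. -/
def multiTime (X : ℝ≥0 → Ω → EuclideanSpace ℝ ι) (t : EuclideanSpace ℝ ι) (ω : Ω) :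
    EuclideanSpace ℝ ι :=
  WithLp.toLp 2 fun k => X (t k).toNNReal ω k

/-- Strong subordination `(X ∘ T)(t) = (X_k(T_k(t)))_k`. -/
def strongSub (X T : ℝ≥0 → Ω → EuclideanSpace ℝ ι) : ℝ≥0 → Ω → EuclideanSpace ℝ ι :=
  fun t ω => multiTime X (T t ω) ω

end Processes

/-! ### Characteristic triplets -/

section Triplets

variable {Ω : Type*} [MeasurableSpace Ω] {ι : Type*} [Fintype ι]

/-- A Lévy measure: a Borel measure on `ℝ^ι ∖ {0}`, seen as a Borel measure on `ℝ^ι` without mass at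
the origin, that integrates `‖x‖² ∧ 1`. -/
def IsLevyMeasure (ν : Measure (EuclideanSpace ℝ ι)) : Prop :=
  ν {0} = 0 ∧ ∫⁻ x, ENNReal.ofReal (min (‖x‖ ^ 2) 1) ∂ν < ∞

/-- The Lévy exponent
`i⟨μ,θ⟩ - ½ θΣθ' + ∫ (e^{i⟨θ,x⟩} - 1 - i⟨θ,x⟩ 1_{‖x‖ ≤ 1}) ν(dx)`. -/
def levyExponent (μ : EuclideanSpace ℝ ι) (S : Matrix ι ι ℝ) (ν : Measure (EuclideanSpace ℝ ι))
    (θ : EuclideanSpace ℝ ι) : ℂ :=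
  Complex.I * (inner ℝ μ θ : ℝ) - 1 / 2 * ((∑ k, ∑ l, θ k * S k l * θ l : ℝ) : ℂ) +
    ∫ x, (Complex.exp (Complex.I * (inner ℝ θ x : ℝ)) - 1 -
      Complex.I * (if ‖x‖ ≤ 1 then (inner ℝ θ x : ℝ) else 0 : ℝ)) ∂ν

/-- `X ∼ L(μ, S, ν)`: `X` is a Lévy process with characteristic triplet `(μ, S, ν)`. -/
structure HasTriplet (P : Measure Ω) (X : ℝ≥0 → Ω → EuclideanSpace ℝ ι)
    (μ : EuclideanSpace ℝ ι) (S : Matrix ι ι ℝ) (ν : Measure (EuclideanSpace ℝ ι)) : Prop where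
  levy : IsLevyProcess P X
  covariance : S.PosSemidef
  levyMeasure : IsLevyMeasure ν
  charFun_eq : ∀ (t : ℝ≥0) (θ : EuclideanSpace ℝ ι),
    charFun (P.map (X t)) θ = Complex.exp (((t : ℝ) : ℂ) * levyExponent μ S ν θ)

/-- `[0,∞)^ι ∖ {0}`. -/
def orthant (ι : Type*) [Fintype ι] : Set (EuclideanSpace ℝ ι) :=
  {t | (∀ k, 0 ≤ t k) ∧ t ≠ 0}

/-- `T ∼ S(d, 𝒯)`: `T` is a subordinator with drift `d ∈ [0,∞)^ι` and Lévy measure `𝒯`, a measure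
on `[0,∞)^ι ∖ {0}` with `∫_{‖t‖ ≤ 1} ‖t‖ 𝒯(dt) < ∞`. The drift is `d = μ - ∫_{‖t‖ ≤ 1} t 𝒯(dt)`
for the characteristic triplet `(μ, 0, 𝒯)` of `T`. -/
structure HasDrift (P : Measure Ω) (T : ℝ≥0 → Ω → EuclideanSpace ℝ ι)
    (d : EuclideanSpace ℝ ι) (𝒯 : Measure (EuclideanSpace ℝ ι)) : Prop where
  subordinator : IsSubordinator P T
  drift_nonneg : ∀ k, 0 ≤ d k
  support : 𝒯 (orthant ι)ᶜ = 0
  finiteVariation : ∫⁻ t in Metric.closedBall 0 1, ENNReal.ofReal ‖t‖ ∂𝒯 < ∞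
  triplet : HasTriplet P T (d + ∫ t in Metric.closedBall 0 1, t ∂𝒯) 0 𝒯

/-- `T` is a drift-less subordinator. -/
def IsDriftless (P : Measure Ω) (T : ℝ≥0 → Ω → EuclideanSpace ℝ ι) : Prop :=
  ∃ 𝒯, HasDrift P T 0 𝒯

/-- A real-valued process is nontrivial if it is not the null process. -/
def IsNontrivial (P : Measure Ω) (X : ℝ≥0 → Ω → ℝ) : Prop :=
  ¬ ∀ᵐ ω ∂P, ∀ t, X t ω = 0

end Triplets

/-! ### The outer product with a multivariate time -/

section Outer

variable {n : ℕ}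

/-- The coordinate projection `x ↦ ∑_{j ∈ J} x_j e_j`. -/
def proj (J : Finset (Fin n)) (x : EuclideanSpace ℝ (Fin n)) : EuclideanSpace ℝ (Fin n) :=
  WithLp.toLp 2 fun j => if j ∈ J then x j else 0

/-- The image of `ν` under a coordinate projection, restricted to `ℝⁿ ∖ {0}`. -/
def projMeasure (J : Finset (Fin n)) (ν : Measure (EuclideanSpace ℝ (Fin n))) :
    Measure (EuclideanSpace ℝ (Fin n)) :=
  (ν.map (proj J)).restrict {0}ᶜ

/-- The spacing `Δt_(k) = t_(k) - t_(k-1)` of the ordered components `t_(1) ≤ … ≤ t_(n)`, where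
`t_(0) = 0`. Here `Tuple.sort t` is an ordering permutation, and indices are shifted by one, so
that `t_(k+1) = t (Tuple.sort t k)`. -/
def spacing (t : EuclideanSpace ℝ (Fin n)) (k : Fin n) : ℝ :=
  t (Tuple.sort (fun j => t j) k) -
    if (k : ℕ) = 0 then 0
    else t (Tuple.sort (fun j => t j) ⟨(k : ℕ) - 1, lt_of_le_of_lt (Nat.sub_le _ _) k.isLt⟩)

/-- The index set `{(k), …, (n)}`. -/
def upperIndices (t : EuclideanSpace ℝ (Fin n)) (k : Fin n) : Finset (Fin n) :=
  (Finset.Ici k).image (Tuple.sort (fun j => t j))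

/-- `t ⋄ μ = (t_k μ_k)_k`. -/
def outerVec (t μ : EuclideanSpace ℝ (Fin n)) : EuclideanSpace ℝ (Fin n) :=
  WithLp.toLp 2 fun k => t k * μ k

/-- `(t ⋄ S)_{kl} = S_{kl} (t_k ∧ t_l)`. -/
def outerMatrix (t : EuclideanSpace ℝ (Fin n)) (S : Matrix (Fin n) (Fin n) ℝ) :
    Matrix (Fin n) (Fin n) ℝ :=
  Matrix.of fun k l => S k l * min (t k) (t l)

/-- `t ⋄ ν = ∑_k Δt_(k) ν_{{(k), …, (n)}}`. -/
def outerMeasure (t : EuclideanSpace ℝ (Fin n)) (ν : Measure (EuclideanSpace ℝ (Fin n))) :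
    Measure (EuclideanSpace ℝ (Fin n)) :=
  ∑ k, ENNReal.ofReal (spacing t k) • projMeasure (upperIndices t k) ν

/-- The compensation term `c(t, ν)`, that is
`∑_{k ≥ 2} Δt_(k) ∫_{‖x‖ > 1} π_{{(k), …, (n)}}(x) 1_{‖π_{{(k), …, (n)}}(x)‖ ≤ 1} ν(dx)`. -/
def compensation (t : EuclideanSpace ℝ (Fin n)) (ν : Measure (EuclideanSpace ℝ (Fin n))) :
    EuclideanSpace ℝ (Fin n) :=
  ∑ k ∈ Finset.univ.filter (fun k : Fin n => 0 < (k : ℕ)), spacing t k •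
    ∫ x in {x | 1 < ‖x‖},
      {y : EuclideanSpace ℝ (Fin n) | ‖y‖ ≤ 1}.indicator id (proj (upperIndices t k) x) ∂ν

end Outer

/-! ### Weak subordination -/

section Weak

variable {Ω Ω' : Type*} [MeasurableSpace Ω] [MeasurableSpace Ω'] {n : ℕ}

/-- The pair `(t, x) ∈ ℝ^{2n}` of two vectors of `ℝⁿ`. -/
def pair (t x : EuclideanSpace ℝ (Fin n)) : EuclideanSpace ℝ (Fin n ⊕ Fin n) :=
  WithLp.toLp 2 (Sum.elim (fun k => t k) fun k => x k)

/-- The second component `Z₂` of an `ℝ^{2n}`-valued process `Z = (Z₁, Z₂)`. -/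
def second (Z : ℝ≥0 → Ω → EuclideanSpace ℝ (Fin n ⊕ Fin n)) :
    ℝ≥0 → Ω → EuclideanSpace ℝ (Fin n) :=
  fun t ω => WithLp.toLp 2 fun k => Z t ω (Sum.inr k)

/-- `m₁ = d + ∫ t ℙ(‖(t, X(t))‖ ≤ 1) 𝒯(dt)`. -/
def weakShift₁ (P : Measure Ω) (X : ℝ≥0 → Ω → EuclideanSpace ℝ (Fin n))
    (d : EuclideanSpace ℝ (Fin n)) (𝒯 : Measure (EuclideanSpace ℝ (Fin n))) :
    EuclideanSpace ℝ (Fin n) :=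
  d + ∫ t in orthant (Fin n), P.real {ω | ‖pair t (multiTime X t ω)‖ ≤ 1} • t ∂𝒯

/-- `m₂ = c(d, 𝒳) + d ⋄ μ + ∫ 𝔼[X(t) 1_{‖(t, X(t))‖ ≤ 1}] 𝒯(dt)`. -/
def weakShift₂ (P : Measure Ω) (X : ℝ≥0 → Ω → EuclideanSpace ℝ (Fin n))
    (d : EuclideanSpace ℝ (Fin n)) (𝒯 : Measure (EuclideanSpace ℝ (Fin n)))
    (μ : EuclideanSpace ℝ (Fin n)) (𝒳 : Measure (EuclideanSpace ℝ (Fin n))) :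
    EuclideanSpace ℝ (Fin n) :=
  compensation d 𝒳 + outerVec d μ +
    ∫ t in orthant (Fin n),
      (∫ ω, {ω | ‖pair t (multiTime X t ω)‖ ≤ 1}.indicator (multiTime X t) ω ∂P) ∂𝒯

/-- The Gaussian covariance matrix with blocks `0, 0, 0, d ⋄ S`. -/
def weakCov (d : EuclideanSpace ℝ (Fin n)) (S : Matrix (Fin n) (Fin n) ℝ) :
    Matrix (Fin n ⊕ Fin n) (Fin n ⊕ Fin n) ℝ :=
  Matrix.fromBlocks 0 0 0 (outerMatrix d S)

/-- The Lévy measure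
`(δ₀ ⊗ (d ⋄ 𝒳))(dt, dx) + 1_{[0,∞)ⁿ∖{0} × ℝⁿ}(t, x) ℙ(X(t) ∈ dx) 𝒯(dt)`; its second summand is the
image of `𝒯 ⊗ ℙ`, restricted to `t ∈ [0,∞)ⁿ∖{0}`, under `(t, ω) ↦ (t, X(t)(ω))`. -/
def weakLevyMeasure (P : Measure Ω) (X : ℝ≥0 → Ω → EuclideanSpace ℝ (Fin n))
    (d : EuclideanSpace ℝ (Fin n)) (𝒯 : Measure (EuclideanSpace ℝ (Fin n)))
    (𝒳 : Measure (EuclideanSpace ℝ (Fin n))) : Measure (EuclideanSpace ℝ (Fin n ⊕ Fin n)) :=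
  (outerMeasure d 𝒳).map (fun x => pair 0 x) +
    ((𝒯.restrict (orthant (Fin n))).prod P).map (fun p => pair p.1 (multiTime X p.1 p.2))

/-- `Z =ᵈ (T, X ⊙ T)`: the process `Z` (possibly on another probability space) is `T` subordinating
`X` in the weak sense. -/
def IsWeakSubordination (P : Measure Ω) (T X : ℝ≥0 → Ω → EuclideanSpace ℝ (Fin n))
    (R : Measure Ω') (Z : ℝ≥0 → Ω' → EuclideanSpace ℝ (Fin n ⊕ Fin n)) : Prop :=
  ∃ (d : EuclideanSpace ℝ (Fin n)) (𝒯 : Measure (EuclideanSpace ℝ (Fin n)))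
    (μ : EuclideanSpace ℝ (Fin n)) (S : Matrix (Fin n) (Fin n) ℝ)
    (𝒳 : Measure (EuclideanSpace ℝ (Fin n))),
    HasDrift P T d 𝒯 ∧ HasTriplet P X μ S 𝒳 ∧
      HasTriplet R Z (pair (weakShift₁ P X d 𝒯) (weakShift₂ P X d 𝒯 μ 𝒳)) (weakCov d S)
        (weakLevyMeasure P X d 𝒯 𝒳)

end Weak

end WeakSubordination

end

/-! Both cases are proved by contradiction, assuming that X(T(t)) and Y(t) have the same law for
every t > 0.

Case (i). Given T(t) = τ, the covariance of X_1(τ_1) and X_2(τ_2) is (τ_1 ∧ τ_2) Cov(X_1(1),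
X_2(1)), because increments after the earlier time are independent of the past. Hence Cov of X(T(t))
is E[T_1(t) ∧ T_2(t)] Cov(X_1(1), X_2(1)) plus a term linear in t (`covariance_strongSub`). For a
Lévy process Y the covariance is linear in t, so E[T_1(t) ∧ T_2(t)] is too. The minimum is
superadditive, strictly so when T(s) and the following increment order their coordinates oppositely.
Independence of increments therefore leaves only one possible order for all times
(`measure_mul_measure_eq_zero`), and T has monotonic components.

Case (ii). Independence puts the Lévy measure of T on the axes (`HasDrift.ae_eq_zero_or_eq_zero`).
Without drift, weak subordination then has no Gaussian part and no common jumps of the two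
components of Z_2, so these are independent at each time. By symmetry X has a real exponent g ≤ 0.
Put G = g(a,b), A = g(a,0), B = g(0,b). Factorization of the characteristic function of X(T(t))
equates the expectations of two exponentials whose exponents differ by (T_1 ∧ T_2)(G - A - B). This
has constant sign, so it vanishes a.s.; since T_1 ∧ T_2 is not a.s. zero at some t, G = A + B
(`exponent_eq_add`). Then X_1 and X_2 are independent, first at fixed times and then as processes
(`IsLevyProcess.indepFun_component`), contrary to hypothesis. -/

noncomputable section

set_option linter.unusedSectionVars false

namespace WeakSubordination

/-! ### Joint measurability of right-continuous paths -/

section RightContinuous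

/-- A process with right-continuous paths is jointly measurable. -/
theorem measurable_uncurry_of_rightContinuous {Ω E : Type*} [MeasurableSpace Ω]
    [TopologicalSpace E] [TopologicalSpace.PseudoMetrizableSpace E] [MeasurableSpace E]
    [BorelSpace E] {x : ℝ≥0 → Ω → E} (hm : ∀ t, Measurable (x t))
    (hc : ∀ ω t, ContinuousWithinAt (fun s => x s ω) (Set.Ici t) t) :
    Measurable (fun p : ℝ≥0 × Ω => x p.1 p.2) := by
  -- For c > 0 the grid time `(⌊c * s⌋₊ + 1) / c` lies above s by at most 1/c, so right continuity
  -- applies; it takes only countably many values.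
  have happrox : ∀ c : ℝ≥0, Measurable (fun p : ℝ≥0 × Ω => x ((⌊c * p.1⌋₊ + 1) / c) p.2) := by
    intro c
    have h : Measurable (fun q : ℕ × Ω => x ((q.1 + 1) / c) q.2) :=
      measurable_from_prod_countable_right fun m => hm ((m + 1) / c)
    have h2 : Measurable (fun p : ℝ≥0 × Ω => (⌊c * p.1⌋₊, p.2)) :=
      Measurable.prodMk (Measurable.nat_floor (by fun_prop)) measurable_snd
    simpa only [Function.comp_def] using h.comp h2
  refine measurable_of_tendsto_metrizable
    (f := fun (n : ℕ) (p : ℝ≥0 × Ω) => x ((⌊((n : ℝ≥0) + 1) * p.1⌋₊ + 1) / ((n : ℝ≥0) + 1)) p.2)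
    (fun n : ℕ => happrox (n + 1)) (tendsto_pi_nhds.2 fun p => ?_)
  refine (hc p.2 p.1).tendsto.comp (tendsto_nhdsWithin_iff.2 ⟨?_, Eventually.of_forall fun n => ?_⟩)
  · have h1 : Tendsto (fun n : ℕ => p.1 + 1 / ((n : ℝ≥0) + 1)) atTop (𝓝 p.1) := by
      simpa using tendsto_const_nhds.add (tendsto_one_div_add_atTop_nhds_zero_nat (𝕜 := ℝ≥0))
    refine tendsto_of_tendsto_of_tendsto_of_le_of_le tendsto_const_nhds h1 (fun n => ?_) fun n => ?_
    · change p.1 ≤ _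
      rw [le_div_iff₀ (by positivity), mul_comm]
      exact (Nat.lt_floor_add_one _).le
    · change _ ≤ p.1 + _
      rw [div_le_iff₀ (by positivity), add_mul p.1, one_div, inv_mul_cancel₀ (by positivity)]
      gcongr
      rw [mul_comm p.1]
      exact Nat.floor_le (by positivity)
  · rw [Set.mem_Ici, le_div_iff₀ (by positivity), mul_comm]
    exact (Nat.lt_floor_add_one _).le

/-- The space of right-continuous paths with the `σ`-algebra generated by the evaluations. -/
abbrev RightContinuousPath (E : Type*) [TopologicalSpace E] : Type _ :=
  {f : ℝ≥0 → E // ∀ t, ContinuousWithinAt f (Set.Ici t) t}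

variable {ι : Type*} [Fintype ι]

/-- Evaluation of a right-continuous path at a multivariate time is measurable. -/
theorem measurable_eval_multiTime :
    Measurable (fun p : EuclideanSpace ℝ ι × RightContinuousPath (EuclideanSpace ℝ ι) =>
      multiTime (fun t (f : RightContinuousPath (EuclideanSpace ℝ ι)) => f.1 t) p.1 p.2) := by
  have h : Measurable (fun q : ℝ≥0 × RightContinuousPath (EuclideanSpace ℝ ι) => q.2.1 q.1) :=
    measurable_uncurry_of_rightContinuous
      (x := fun t (f : RightContinuousPath (EuclideanSpace ℝ ι)) => f.1 t)
      (fun t => (measurable_pi_apply t).comp measurable_subtype_coe) fun f t => f.2 t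
  refine (WithLp.measurable_toLp 2 _).comp (measurable_pi_lambda _ fun k => ?_)
  have h2 : Measurable (fun p : EuclideanSpace ℝ ι × RightContinuousPath (EuclideanSpace ℝ ι) =>
      ((p.1 k).toNNReal, p.2)) := by fun_prop
  have h3 := h.comp h2
  fun_prop

end RightContinuous

/-! ### Lévy processes at independent multivariate times -/

section Modification

variable {Ω : Type*} [MeasurableSpace Ω] {P : Measure Ω} {ι : Type*} [Fintype ι]
  {X : ℝ≥0 → Ω → EuclideanSpace ℝ ι}

/-- A Lévy process is a.s. equal to a random element of the space of right-continuous paths. -/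
theorem IsLevyProcess.exists_rightContinuousPath (hX : IsLevyProcess P X) :
    ∃ ρ : Ω → RightContinuousPath (EuclideanSpace ℝ ι), Measurable ρ ∧
      ∀ᵐ ω ∂P, (ρ ω).1 = path X ω := by
  classical
  obtain ⟨S, hS, hPS⟩ := eventually_iff_exists_mem.1 hX.cadlag
  -- The good set need not be measurable; resetting paths to 0 on a measurable null superset of its
  -- complement keeps every evaluation measurable.
  have hN := measurableSet_toMeasurable P Sᶜ
  have hN0 : P (toMeasurable P Sᶜ) = 0 := by rw [measure_toMeasurable]; exact hS
  refine ⟨fun ω => ⟨fun t => if ω ∈ toMeasurable P Sᶜ then 0 else X t ω, fun t => ?_⟩, ?_, ?_⟩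
  · by_cases h : ω ∈ toMeasurable P Sᶜ
    · simpa [h] using continuousWithinAt_const
    · have : ω ∈ S := by
        by_contra h'
        exact h (subset_toMeasurable P Sᶜ h')
      simpa [h] using (hPS ω this t).1
  · exact Measurable.subtype_mk (measurable_pi_lambda _ fun t =>
      Measurable.ite hN measurable_const (hX.measurable t))
  · filter_upwards [measure_eq_zero_iff_ae_notMem.1 hN0] with ω hω
    funext t
    simp [hω, path]

theorem multiTime_eq_eval {ω : Ω} {f : RightContinuousPath (EuclideanSpace ℝ ι)}
    (h : f.1 = path X ω) (t : EuclideanSpace ℝ ι) :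
    multiTime X t ω =
      multiTime (fun s (f : RightContinuousPath (EuclideanSpace ℝ ι)) => f.1 s) t f := by
  simp [multiTime, h, path]

theorem IsLevyProcess.aemeasurable_multiTime [SFinite P] (hX : IsLevyProcess P X)
    (ν : Measure (EuclideanSpace ℝ ι)) [SFinite ν] :
    AEMeasurable (fun p : EuclideanSpace ℝ ι × Ω => multiTime X p.1 p.2) (ν.prod P) := by
  obtain ⟨ρ, hρ, hρX⟩ := hX.exists_rightContinuousPath
  refine ⟨_, measurable_eval_multiTime.comp (measurable_id.prodMap hρ), ?_⟩
  filter_upwards [Measure.quasiMeasurePreserving_snd.ae hρX] with p hp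
  exact multiTime_eq_eval hp p.1

theorem IsLevyProcess.aemeasurable_multiTime_comp (hX : IsLevyProcess P X)
    {τ : Ω → EuclideanSpace ℝ ι} (hτ : Measurable τ) :
    AEMeasurable (fun ω => multiTime X (τ ω) ω) P := by
  obtain ⟨ρ, hρ, hρX⟩ := hX.exists_rightContinuousPath
  refine ⟨_, measurable_eval_multiTime.comp (hτ.prodMk hρ), ?_⟩
  filter_upwards [hρX] with ω hω
  exact multiTime_eq_eval hω _

/-- The law of a Lévy process evaluated at an independent multivariate time. -/
theorem IsLevyProcess.map_multiTime_comp [IsProbabilityMeasure P] (hX : IsLevyProcess P X)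
    {τ : Ω → EuclideanSpace ℝ ι} (hτ : Measurable τ) (hind : IndepFun τ (path X) P) :
    P.map (fun ω => multiTime X (τ ω) ω) =
      ((P.map τ).prod P).map (fun p => multiTime X p.1 p.2) := by
  obtain ⟨ρ, hρ, hρX⟩ := hX.exists_rightContinuousPath
  have : IsProbabilityMeasure (P.map τ) := Measure.isProbabilityMeasure_map hτ.aemeasurable
  have hind' : IndepFun τ ρ P := by
    have h : IndepFun τ (fun ω => (ρ ω).1) P :=
      hind.congr (EventuallyEq.refl _ _) (hρX.mono fun _ h => h.symm)
    -- The path space carries the σ-algebra pulled back along the coercion, so `ρ` and its coercion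
    -- generate the same σ-algebra on Ω.
    rw [IndepFun_iff_Indep] at h ⊢
    convert h using 1
    exact MeasurableSpace.comap_comp
  have hprod := (indepFun_iff_map_prod_eq_prod_map_map hτ.aemeasurable hρ.aemeasurable).1 hind'
  have h1 : P.map (fun ω => multiTime X (τ ω) ω) = (P.map fun ω => (τ ω, ρ ω)).map
      (fun p => multiTime (fun t f => f.1 t) p.1 p.2) := by
    rw [Measure.map_map measurable_eval_multiTime (hτ.prodMk hρ)]
    refine Measure.map_congr ?_
    filter_upwards [hρX] with ω hω
    exact multiTime_eq_eval hω _
  have h2 : ((P.map τ).prod P).map (fun p => multiTime X p.1 p.2) =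
      ((P.map τ).prod (P.map ρ)).map (fun p => multiTime (fun t f => f.1 t) p.1 p.2) := by
    have h3 := Measure.map_prod_map (P.map τ) P measurable_id hρ
    rw [Measure.map_id] at h3
    rw [h3, Measure.map_map measurable_eval_multiTime (measurable_id.prodMap hρ)]
    refine Measure.map_congr ?_
    filter_upwards [Measure.quasiMeasurePreserving_snd.ae hρX] with p hp
    exact multiTime_eq_eval hp p.1
  rw [h1, h2, hprod]

/-- Fubini for a jointly measurable version. Measurability in time is what upgrades additivity of
moments to linearity. -/
theorem IsLevyProcess.measurable_integral [IsProbabilityMeasure P] (hX : IsLevyProcess P X)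
    {f : EuclideanSpace ℝ ι → ℝ} (hf : Measurable f) :
    Measurable (fun t => ∫ ω, f (X t ω) ∂P) := by
  obtain ⟨ρ, hρ, hρX⟩ := hX.exists_rightContinuousPath
  have h : Measurable (fun q : ℝ≥0 × RightContinuousPath (EuclideanSpace ℝ ι) => q.2.1 q.1) :=
    measurable_uncurry_of_rightContinuous
      (x := fun t (f : RightContinuousPath (EuclideanSpace ℝ ι)) => f.1 t)
      (fun t => (measurable_pi_apply t).comp measurable_subtype_coe) fun f t => f.2 t
  have h2 : StronglyMeasurable (fun q : ℝ≥0 × Ω => f ((ρ q.2).1 q.1)) :=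
    (hf.comp (h.comp (measurable_fst.prodMk (hρ.comp measurable_snd)))).stronglyMeasurable
  convert (h2.integral_prod_right' (ν := P)).measurable using 2 with t
  refine integral_congr_ae ?_
  filter_upwards [hρX] with ω hω
  simp [hω, path]

end Modification

/-! ### Linearity in time of first and second moments -/

section Additive

/-- A measurable additive function on `[0,∞)` is linear. -/
theorem eq_mul_of_measurable_of_add {f : ℝ≥0 → ℝ} (hf : Measurable f)
    (hadd : ∀ s t, f (s + t) = f s + f t) (t : ℝ≥0) : f t = t * f 1 := by
  have h0 : f 0 = 0 := by simpa using hadd 0 0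
  -- The odd extension of f is an additive map on ℝ; measurable homomorphisms are continuous, hence
  -- linear.
  let F : ℝ →+ ℝ :=
    { toFun := fun x => f x.toNNReal - f (-x).toNNReal
      map_zero' := by simp
      map_add' := fun x y => by
        have h : (x + y).toNNReal + (-x).toNNReal + (-y).toNNReal =
            (-(x + y)).toNNReal + x.toNNReal + y.toNNReal := by
          ext
          push_cast [Real.coe_toNNReal']
          have hz : ∀ z : ℝ, max z 0 - max (-z) 0 = z := fun z => by
            rcases le_total z 0 with h | h
            · rw [max_eq_right h, max_eq_left (by linarith)]; ring
            · rw [max_eq_left h, max_eq_right (by linarith)]; ring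
          linarith [hz x, hz y, hz (x + y)]
        have h' := congrArg f h
        simp only [hadd] at h'
        linarith }
  have hF : Measurable F := (hf.comp measurable_real_toNNReal).sub
    (hf.comp (measurable_real_toNNReal.comp measurable_neg))
  have h := map_real_smul F (Measure.AddMonoidHom.continuous_of_measurable F hF) (t : ℝ) 1
  have h1 : ∀ s : ℝ≥0, F s = f s := fun s => by
    change f (s : ℝ).toNNReal - f (-(s : ℝ)).toNNReal = f s
    rw [Real.toNNReal_coe, Real.toNNReal_of_nonpos (by simp), h0, sub_zero]
  have h2 := h1 1
  simp only [NNReal.coe_one] at h2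
  rw [smul_eq_mul, mul_one, h1, h2, smul_eq_mul] at h
  exact h

end Additive

section IndepSum

variable {Ω E : Type*} [MeasurableSpace Ω] {P : Measure Ω} [NormedAddCommGroup E]
  [SecondCountableTopology E] [MeasurableSpace E] [BorelSpace E]

/-- If the sum of two independent random vectors is square integrable, so is the first one. -/
theorem memLp_two_left_of_add [IsProbabilityMeasure P] {U V : Ω → E}
    (hU : Measurable U) (hV : Measurable V) (hUV : IndepFun U V P)
    (h : MemLp (fun ω => U ω + V ω) 2 P) : MemLp U 2 P := by
  have : IsProbabilityMeasure (P.map U) := Measure.isProbabilityMeasure_map hU.aemeasurable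
  have : IsProbabilityMeasure (P.map V) := Measure.isProbabilityMeasure_map hV.aemeasurable
  have hprod := (indepFun_iff_map_prod_eq_prod_map_map hU.aemeasurable hV.aemeasurable).1 hUV
  have h1 : MemLp (fun p : E × E => p.1 + p.2) 2 ((P.map U).prod (P.map V)) := by
    rw [← hprod, memLp_map_measure_iff (by fun_prop) (by fun_prop)]
    exact h
  rw [memLp_two_iff_integrable_sq_norm (by fun_prop)] at h1
  -- By Fubini u + v is square integrable in u for almost every v, and a single such v suffices.
  obtain ⟨v, hv⟩ := h1.prod_left_ae.exists
  have h2 : MemLp (fun u : E => u + v) 2 (P.map U) :=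
    (memLp_two_iff_integrable_sq_norm (by fun_prop)).2 hv
  have h3 : MemLp (fun u : E => u) 2 (P.map U) := by
    simpa [Pi.sub_def] using h2.sub (memLp_const v)
  exact (memLp_map_measure_iff (by fun_prop) hU.aemeasurable).1 h3

end IndepSum

section Moments

variable {Ω : Type*} [MeasurableSpace Ω] {P : Measure Ω} {ι : Type*} [Fintype ι]
  {X : ℝ≥0 → Ω → EuclideanSpace ℝ ι}

theorem IsLevyProcess.indepFun_increment (hX : IsLevyProcess P X) {s t : ℝ≥0} (hst : s ≤ t) :
    IndepFun (X s) (fun ω => X t ω - X s ω) P :=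
  hX.indepIncrements.indepFun_eval_sub (zero_le (a := s)) hst hX.zero

theorem IsLevyProcess.identDistrib_increment (hX : IsLevyProcess P X) {s t : ℝ≥0} (hst : s ≤ t) :
    IdentDistrib (fun ω => X t ω - X s ω) (X (t - s)) P P := by
  simpa [add_tsub_cancel_of_le hst] using hX.stationaryIncrements s (t - s)

/-- If `X 1` is square integrable, so is `X t` for all `t`. -/
theorem IsLevyProcess.memLp_two [IsProbabilityMeasure P] (hX : IsLevyProcess P X)
    (h : MemLp (X 1) 2 P) (t : ℝ≥0) : MemLp (X t) 2 P := by
  have hnat : ∀ n : ℕ, MemLp (X n) 2 P := by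
    intro n
    induction n with
    | zero =>
      refine (memLp_congr_ae ?_).2 (MemLp.zero (ε := EuclideanSpace ℝ ι))
      filter_upwards [hX.zero] with ω hω
      simpa using hω
    | succ n ih =>
      have h1 : MemLp (fun ω => X (n + 1) ω - X n ω) 2 P :=
        (hX.stationaryIncrements n 1).memLp_iff.2 h
      simpa [Pi.add_def] using ih.add h1
  -- X(n) is X(t) plus an independent increment, so integrability descends from the integer time n
  -- to t.
  obtain ⟨n, hn⟩ := exists_nat_ge t
  refine memLp_two_left_of_add (hX.measurable t) ((hX.measurable n).sub (hX.measurable t))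
    (hX.indepFun_increment hn) ?_
  simpa using hnat n

variable [IsProbabilityMeasure P]

theorem IsLevyProcess.memLp_two_eval (hX : IsLevyProcess P X) (h : MemLp (X 1) 2 P) (t : ℝ≥0)
    (k : ι) : MemLp (fun ω => X t ω k) 2 P :=
  memLp_piLp_iff.1 (hX.memLp_two h t) k

theorem IsLevyProcess.integral_eval (hX : IsLevyProcess P X) (h : MemLp (X 1) 2 P) (k : ι)
    (t : ℝ≥0) : ∫ ω, X t ω k ∂P = t * ∫ ω, X 1 ω k ∂P := by
  refine eq_mul_of_measurable_of_add (f := fun t => ∫ ω, X t ω k ∂P)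
    (hX.measurable_integral (f := fun x => x k) (by fun_prop)) (fun s t => ?_) t
  have hid := (hX.stationaryIncrements s t).comp (u := fun x : EuclideanSpace ℝ ι => x k)
    (by fun_prop)
  have h1 := hid.integral_eq
  simp only [Function.comp_def, PiLp.sub_apply] at h1
  rw [integral_sub] at h1
  · linarith
  · exact (hX.memLp_two_eval h _ k).integrable one_le_two
  · exact (hX.memLp_two_eval h _ k).integrable one_le_two

theorem covariance_congr_identDistrib {Ω' : Type*} [MeasurableSpace Ω'] {Q : Measure Ω'}
    {U : Ω → EuclideanSpace ℝ ι} {V : Ω' → EuclideanSpace ℝ ι} (h : IdentDistrib U V P Q)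
    (i j : ι) : cov[fun ω => U ω i, fun ω => U ω j; P] = cov[fun ω => V ω i, fun ω => V ω j; Q] := by
  rw [← covariance_map_fun (X := fun x : EuclideanSpace ℝ ι => x i)
      (Y := fun x : EuclideanSpace ℝ ι => x j) (by fun_prop) (by fun_prop) h.aemeasurable_fst,
    ← covariance_map_fun (X := fun x : EuclideanSpace ℝ ι => x i)
      (Y := fun x : EuclideanSpace ℝ ι => x j) (by fun_prop) (by fun_prop) h.aemeasurable_snd,
    h.map_eq]

/-- Independence of increments: for `s ≤ t`, `X t` may be replaced by `X s`. -/
theorem IsLevyProcess.covariance_of_le (hX : IsLevyProcess P X) (h : MemLp (X 1) 2 P) {s t : ℝ≥0}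
    (hst : s ≤ t) (i j : ι) :
    cov[fun ω => X s ω i, fun ω => X t ω j; P] = cov[fun ω => X s ω i, fun ω => X s ω j; P] := by
  have hs := fun k => hX.memLp_two_eval h s k
  have ht := fun k => hX.memLp_two_eval h t k
  have h0 : cov[fun ω => X s ω i, fun ω => X t ω j - X s ω j; P] = 0 :=
    ((hX.indepFun_increment hst).comp (φ := fun x : EuclideanSpace ℝ ι => x i)
      (ψ := fun x : EuclideanSpace ℝ ι => x j) (by fun_prop) (by fun_prop)).covariance_eq_zero
        (hs i) ((ht j).sub (hs j))
  rw [covariance_fun_sub_right (hs i) (ht j) (hs j)] at h0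
  linarith

theorem IsLevyProcess.covariance_eval (hX : IsLevyProcess P X) (h : MemLp (X 1) 2 P) (i j : ι)
    (t : ℝ≥0) : cov[fun ω => X t ω i, fun ω => X t ω j; P] =
      t * cov[fun ω => X 1 ω i, fun ω => X 1 ω j; P] := by
  have hL := fun t k => hX.memLp_two_eval h t k
  refine eq_mul_of_measurable_of_add (f := fun t => cov[fun ω => X t ω i, fun ω => X t ω j; P])
    ?_ (fun s t => ?_) t
  · have h1 : (fun t => cov[fun ω => X t ω i, fun ω => X t ω j; P]) = fun t =>
        ∫ ω, X t ω i * X t ω j ∂P - (∫ ω, X t ω i ∂P) * ∫ ω, X t ω j ∂P := by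
      funext t
      exact covariance_eq_sub (hL t i) (hL t j)
    rw [h1]
    exact (hX.measurable_integral (f := fun x => x i * x j) (by fun_prop)).sub
      ((hX.measurable_integral (f := fun x => x i) (by fun_prop)).mul
        (hX.measurable_integral (f := fun x => x j) (by fun_prop)))
  -- In the covariance of the increment over [s, s + t] both mixed terms reduce to the covariance at
  -- time s.
  · have h1 := covariance_congr_identDistrib (hX.stationaryIncrements s t) i j
    simp only [PiLp.sub_apply] at h1
    rw [covariance_fun_sub_fun_sub (hL _ i) (hL _ i) (hL _ j) (hL _ j),
      covariance_comm (fun ω => X (s + t) ω i) (fun ω => X s ω j),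
      hX.covariance_of_le h le_self_add, hX.covariance_of_le h le_self_add,
      covariance_comm (fun ω => X s ω j)] at h1
    linarith

theorem IsLevyProcess.covariance_eval_eval (hX : IsLevyProcess P X) (h : MemLp (X 1) 2 P) (i j : ι)
    (s t : ℝ≥0) : cov[fun ω => X s ω i, fun ω => X t ω j; P] =
      min (s : ℝ) t * cov[fun ω => X 1 ω i, fun ω => X 1 ω j; P] := by
  rcases le_total s t with hst | hst
  · rw [hX.covariance_of_le h hst, hX.covariance_eval h, min_eq_left (by exact_mod_cast hst)]
  · rw [covariance_comm, hX.covariance_of_le h hst, covariance_comm, hX.covariance_eval h,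
      min_eq_right (by exact_mod_cast hst)]

/-- The uncentred form is needed because second moments, unlike covariances, can be averaged over
random times. -/
theorem IsLevyProcess.integral_mul_eval (hX : IsLevyProcess P X) (h : MemLp (X 1) 2 P) (i j : ι)
    (s t : ℝ≥0) : ∫ ω, X s ω i * X t ω j ∂P =
      min (s : ℝ) t * cov[fun ω => X 1 ω i, fun ω => X 1 ω j; P] +
        (s * t) * ((∫ ω, X 1 ω i ∂P) * ∫ ω, X 1 ω j ∂P) := by
  have h1 := covariance_eq_sub (hX.memLp_two_eval h s i) (hX.memLp_two_eval h t j)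
  rw [hX.covariance_eval_eval h, hX.integral_eval h i s, hX.integral_eval h j t] at h1
  simp only [Pi.mul_apply] at h1
  linarith

end Moments

/-! ### Subordinators and monotone paths -/

section Subordinators

variable {Ω : Type*} [MeasurableSpace Ω] {P : Measure Ω} {ι κ : Type*} [Fintype ι] [Fintype κ]
  {T X : ℝ≥0 → Ω → EuclideanSpace ℝ ι}

theorem IsSubordinator.ae_nonneg (hT : IsSubordinator P T) :
    ∀ᵐ ω ∂P, ∀ t k, 0 ≤ T t ω k := by
  filter_upwards [hT.levy.zero, hT.monotone] with ω h0 hm t k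
  have h := hm k (zero_le (a := t))
  simpa [h0] using h

theorem indepFun_eval_path (hTX : IndepFun (path T) (path X) P) (t : ℝ≥0) :
    IndepFun (T t) (path X) P :=
  hTX.comp (φ := fun f : ℝ≥0 → EuclideanSpace ℝ ι => f t) (ψ := id)
    (measurable_pi_apply (X := fun _ : ℝ≥0 => EuclideanSpace ℝ ι) t) measurable_id

/-- A linear image of a Lévy process is a Lévy process. -/
theorem IsLevyProcess.map (hX : IsLevyProcess P X)
    (L : EuclideanSpace ℝ ι →L[ℝ] EuclideanSpace ℝ κ) :
    IsLevyProcess P (fun t ω => L (X t ω)) where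
  measurable t := L.continuous.measurable.comp (hX.measurable t)
  zero := by filter_upwards [hX.zero] with ω hω; simp [hω]
  indepIncrements := hX.indepIncrements.map L
  stationaryIncrements s t := by
    simpa [Function.comp_def] using (hX.stationaryIncrements s t).comp L.continuous.measurable
  cadlag := by
    filter_upwards [hX.cadlag] with ω hω t
    obtain ⟨h1, l, hl⟩ := hω t
    exact ⟨L.continuous.continuousAt.comp_continuousWithinAt h1, L l,
      (L.continuous.tendsto l).comp hl⟩

/-- A right-continuous function that is nondecreasing on the rationals is nondecreasing. -/
theorem monotone_of_rightContinuous {f : ℝ≥0 → ℝ}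
    (hc : ∀ t, ContinuousWithinAt f (Set.Ici t) t)
    (hq : ∀ p q : ℚ, (p : ℝ).toNNReal ≤ (q : ℝ).toNNReal →
      f (p : ℝ).toNNReal ≤ f (q : ℝ).toNNReal) : Monotone f := by
  have hfreq : ∀ t u : ℝ≥0, t < u →
      ∃ᶠ r in 𝓝[>] t, ∃ q : ℚ, (q : ℝ).toNNReal = r ∧ t < r ∧ r < u := by
    intro t u htu
    rw [frequently_iff]
    intro U hU
    obtain ⟨v, hv, hvU⟩ := (mem_nhdsGT_iff_exists_Ioo_subset' htu).1 hU
    obtain ⟨q, -, hq1, hq2⟩ := (NNReal.lt_iff_exists_rat_btwn t (min v u)).1 (lt_min hv htu)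
    exact ⟨_, hvU ⟨hq1, hq2.trans_le (min_le_left _ _)⟩, q, rfl, hq1,
      hq2.trans_le (min_le_right _ _)⟩
  have hlim : ∀ t, Tendsto f (𝓝[>] t) (𝓝 (f t)) := fun t =>
    (hc t).tendsto.mono_left (nhdsWithin_mono _ Set.Ioi_subset_Ici_self)
  -- The inequality is extended in two limits from the right: first in the left endpoint, then in
  -- the right one.
  have h1 : ∀ (s : ℝ≥0) (q : ℚ), s < (q : ℝ).toNNReal → f s ≤ f (q : ℝ).toNNReal :=
    fun s q hs => le_of_tendsto_of_frequently (hlim s) <| (hfreq s _ hs).mono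
      fun r ⟨p, hp, _, hr⟩ => by
        rw [← hp] at hr ⊢
        exact hq p q hr.le
  intro s t hst
  exact ge_of_tendsto_of_frequently (hlim t) <| (hfreq t (t + 1) (by simp)).mono
    fun r ⟨p, hp, hr, _⟩ => by
      rw [← hp] at hr ⊢
      exact h1 s p (hst.trans_lt hr)

/-- A real Lévy process with a.s. nonnegative marginals is a subordinator. -/
theorem isSubordinator_scalar_of_nonneg {D : ℝ≥0 → Ω → ℝ} (hD : IsLevyProcess P (scalar D))
    (h : ∀ t, ∀ᵐ ω ∂P, 0 ≤ D t ω) : IsSubordinator P (scalar D) := by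
  refine ⟨hD, ?_⟩
  have hinc : ∀ s t : ℝ≥0, s ≤ t → ∀ᵐ ω ∂P, D s ω ≤ D t ω := by
    intro s t hst
    have h1 := (hD.identDistrib_increment hst).symm.ae_snd (p := fun x => 0 ≤ x 0)
      (measurableSet_le measurable_const (by fun_prop)) (by simpa [scalar] using h (t - s))
    filter_upwards [h1] with ω hω
    simpa [scalar] using hω
  -- Rational times keep the union of exceptional null sets countable; right continuity supplies the
  -- other times.
  have hall : ∀ᵐ ω ∂P, ∀ p q : ℚ, (p : ℝ).toNNReal ≤ (q : ℝ).toNNReal →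
      D (p : ℝ).toNNReal ω ≤ D (q : ℝ).toNNReal ω := by
    rw [ae_all_iff]; intro p
    rw [ae_all_iff]; intro q
    by_cases hpq : (p : ℝ).toNNReal ≤ (q : ℝ).toNNReal
    · filter_upwards [hinc _ _ hpq] with ω hω _ using hω
    · exact ae_of_all _ fun ω h => absurd h hpq
  filter_upwards [hall, hD.cadlag] with ω h1 h2 k
  fin_cases k
  refine monotone_of_rightContinuous (fun t => ?_) h1
  exact ((EuclideanSpace.proj (𝕜 := ℝ) (0 : Fin 1)).continuous.continuousAt.comp_continuousWithinAt
    (h2 t).1)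

end Subordinators

/-! ### Covariance under strong subordination -/

section StrongCovariance

variable {Ω : Type*} [MeasurableSpace Ω] {P : Measure Ω} [IsProbabilityMeasure P]
  {ι : Type*} [Fintype ι] {T X : ℝ≥0 → Ω → EuclideanSpace ℝ ι}

/-- The law of `X` at an independent multivariate time, as an identity of distributions. -/
theorem identDistrib_strongSub (hT : IsSubordinator P T) (hX : IsLevyProcess P X)
    (hTX : IndepFun (path T) (path X) P) (t : ℝ≥0) :
    IdentDistrib (fun p : EuclideanSpace ℝ ι × Ω => multiTime X p.1 p.2) (strongSub X T t)
      ((P.map (T t)).prod P) P := by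
  have : IsProbabilityMeasure (P.map (T t)) :=
    Measure.isProbabilityMeasure_map (hT.levy.measurable t).aemeasurable
  exact ⟨hX.aemeasurable_multiTime _, hX.aemeasurable_multiTime_comp (hT.levy.measurable t),
    (hX.map_multiTime_comp (hT.levy.measurable t) (indepFun_eval_path hTX t)).symm⟩

theorem IsSubordinator.ae_map_nonneg (hT : IsSubordinator P T) (t : ℝ≥0) :
    ∀ᵐ τ ∂(P.map (T t)), ∀ k, 0 ≤ τ k := by
  rw [ae_map_iff (hT.levy.measurable t).aemeasurable]
  · filter_upwards [hT.ae_nonneg] with ω h using h t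
  · simp only [Set.ofPred_forall]
    exact MeasurableSet.iInter fun k => measurableSet_le measurable_const (by fun_prop)

/-- Integrating over X at a frozen time τ leaves τ_k times a variance plus τ_k² times a squared
mean, which ν integrates. -/
theorem memLp_multiTime (hX : IsLevyProcess P X) (hX1 : MemLp (X 1) 2 P)
    {ν : Measure (EuclideanSpace ℝ ι)} [IsProbabilityMeasure ν] (hν : MemLp id 2 ν)
    (hpos : ∀ᵐ τ ∂ν, ∀ k, 0 ≤ τ k) (k : ι) :
    MemLp (fun p : EuclideanSpace ℝ ι × Ω => multiTime X p.1 p.2 k) 2 (ν.prod P) := by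
  have hmeas : AEStronglyMeasurable (fun p : EuclideanSpace ℝ ι × Ω => multiTime X p.1 p.2 k)
      (ν.prod P) := ((EuclideanSpace.proj (𝕜 := ℝ) k).continuous.measurable.comp_aemeasurable
    (hX.aemeasurable_multiTime ν)).aestronglyMeasurable
  have hmeas2 : AEStronglyMeasurable (fun p : EuclideanSpace ℝ ι × Ω =>
      (multiTime X p.1 p.2 k : ℝ) ^ 2) (ν.prod P) := hmeas.pow 2
  rw [memLp_two_iff_integrable_sq hmeas, integrable_prod_iff hmeas2]
  have hk : MemLp (fun τ : EuclideanSpace ℝ ι => τ k) 2 ν := memLp_piLp_iff.1 hν k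
  refine ⟨ae_of_all _ fun τ => (hX.memLp_two_eval hX1 (τ k).toNNReal k).integrable_sq, ?_⟩
  have h1 : Integrable (fun τ : EuclideanSpace ℝ ι =>
      τ k * cov[fun ω => X 1 ω k, fun ω => X 1 ω k; P] +
        τ k ^ 2 * ((∫ ω, X 1 ω k ∂P) * ∫ ω, X 1 ω k ∂P)) ν :=
    ((hk.integrable one_le_two).mul_const _).add (hk.integrable_sq.mul_const _)
  refine h1.congr ?_
  filter_upwards [hpos] with τ hτ
  have h2 := hX.integral_mul_eval hX1 k k (τ k).toNNReal (τ k).toNNReal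
  simp only [min_self, Real.coe_toNNReal _ (hτ k)] at h2
  simp only [Real.norm_eq_abs, abs_pow, sq_abs]
  rw [pow_two, ← h2]
  simp [multiTime, pow_two]

/-- The covariance of two components of a Lévy process at an independent time. -/
theorem covariance_multiTime (hX : IsLevyProcess P X) (hX1 : MemLp (X 1) 2 P)
    {ν : Measure (EuclideanSpace ℝ ι)} [IsProbabilityMeasure ν] (hν : MemLp id 2 ν)
    (hpos : ∀ᵐ τ ∂ν, ∀ k, 0 ≤ τ k) (i j : ι) :
    cov[fun p : EuclideanSpace ℝ ι × Ω => multiTime X p.1 p.2 i,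
        fun p => multiTime X p.1 p.2 j; ν.prod P] =
      (∫ τ, min (τ i) (τ j) ∂ν) * cov[fun ω => X 1 ω i, fun ω => X 1 ω j; P] +
        cov[fun τ => τ i, fun τ => τ j; ν] * ((∫ ω, X 1 ω i ∂P) * ∫ ω, X 1 ω j ∂P) := by
  have hk : ∀ k, MemLp (fun τ : EuclideanSpace ℝ ι => τ k) 2 ν := memLp_piLp_iff.1 hν
  have hF := memLp_multiTime hX hX1 hν hpos
  have hmean : ∀ k, ∫ p : EuclideanSpace ℝ ι × Ω, multiTime X p.1 p.2 k ∂(ν.prod P) =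
      (∫ τ, τ k ∂ν) * ∫ ω, X 1 ω k ∂P := by
    intro k
    rw [integral_prod _ ((hF k).integrable one_le_two), ← integral_mul_const]
    refine integral_congr_ae ?_
    filter_upwards [hpos] with τ hτ
    have h := hX.integral_eval hX1 k (τ k).toNNReal
    rw [Real.coe_toNNReal _ (hτ k)] at h
    exact h
  have hmul : ∫ p : EuclideanSpace ℝ ι × Ω, multiTime X p.1 p.2 i * multiTime X p.1 p.2 j
      ∂(ν.prod P) = (∫ τ, min (τ i) (τ j) ∂ν) * cov[fun ω => X 1 ω i, fun ω => X 1 ω j; P] +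
        (∫ τ, τ i * τ j ∂ν) * ((∫ ω, X 1 ω i ∂P) * ∫ ω, X 1 ω j ∂P) := by
    have hij : Integrable (fun p : EuclideanSpace ℝ ι × Ω =>
      multiTime X p.1 p.2 i * multiTime X p.1 p.2 j) (ν.prod P) := (hF i).integrable_mul (hF j)
    rw [integral_prod _ hij, ← integral_mul_const,
      ← integral_mul_const, ← integral_add]
    · refine integral_congr_ae ?_
      filter_upwards [hpos] with τ hτ
      have h := hX.integral_mul_eval hX1 i j (τ i).toNNReal (τ j).toNNReal
      rw [Real.coe_toNNReal _ (hτ i), Real.coe_toNNReal _ (hτ j)] at h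
      exact h
    · exact (((hk i).integrable one_le_two).inf ((hk j).integrable one_le_two)).mul_const _
    · exact ((hk i).integrable_mul (hk j)).mul_const _
  rw [covariance_eq_sub (hF i) (hF j), covariance_eq_sub (hk i) (hk j)]
  simp only [Pi.mul_apply]
  rw [hmean, hmean, hmul]
  ring

/-- The covariance of two components of a strongly subordinated process. -/
theorem covariance_strongSub (hT : IsSubordinator P T) (hX : IsLevyProcess P X)
    (hTX : IndepFun (path T) (path X) P) (hT1 : MemLp (T 1) 2 P) (hX1 : MemLp (X 1) 2 P)
    (i j : ι) (t : ℝ≥0) :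
    cov[fun ω => strongSub X T t ω i, fun ω => strongSub X T t ω j; P] =
      (∫ ω, min (T t ω i) (T t ω j) ∂P) * cov[fun ω => X 1 ω i, fun ω => X 1 ω j; P] +
        t * cov[fun ω => T 1 ω i, fun ω => T 1 ω j; P] *
          ((∫ ω, X 1 ω i ∂P) * ∫ ω, X 1 ω j ∂P) := by
  have hm := (hT.levy.measurable t).aemeasurable (μ := P)
  have : IsProbabilityMeasure (P.map (T t)) := Measure.isProbabilityMeasure_map hm
  rw [← covariance_congr_identDistrib (identDistrib_strongSub hT hX hTX t),
    covariance_multiTime hX hX1 ((memLp_map_measure_iff (by fun_prop) hm).2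
      (hT.levy.memLp_two hT1 t)) (hT.ae_map_nonneg t), integral_map hm (by fun_prop),
    covariance_map_fun (by fun_prop) (by fun_prop) hm, hT.levy.covariance_eval hT1]

theorem memLp_strongSub (hT : IsSubordinator P T) (hX : IsLevyProcess P X)
    (hTX : IndepFun (path T) (path X) P) (hT1 : MemLp (T 1) 2 P) (hX1 : MemLp (X 1) 2 P)
    (t : ℝ≥0) : MemLp (strongSub X T t) 2 P := by
  have hm := (hT.levy.measurable t).aemeasurable (μ := P)
  have : IsProbabilityMeasure (P.map (T t)) := Measure.isProbabilityMeasure_map hm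
  rw [← (identDistrib_strongSub hT hX hTX t).memLp_iff, memLp_piLp_iff]
  exact memLp_multiTime hX hX1 ((memLp_map_measure_iff (by fun_prop) hm).2
      (hT.levy.memLp_two hT1 t)) (hT.ae_map_nonneg t)

end StrongCovariance

/-! ### Case (i): the expected minimum and monotonic components -/

section MonotonicComponents

variable {Ω : Type*} [MeasurableSpace Ω] {P : Measure Ω} [IsProbabilityMeasure P]
  {T : ℝ≥0 → Ω → EuclideanSpace ℝ (Fin 2)}

/-- If `t ↦ 𝔼[T₁(t) ∧ T₂(t)]` is additive, then increments of `T₁ - T₂` over disjoint intervals do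
not change sign. -/
theorem measure_mul_measure_eq_zero (hT : IsLevyProcess P T) (hT1 : MemLp (T 1) 2 P)
    {s t : ℝ≥0} (hadd : ∫ ω, min (T (s + t) ω 0) (T (s + t) ω 1) ∂P =
      ∫ ω, min (T s ω 0) (T s ω 1) ∂P + ∫ ω, min (T t ω 0) (T t ω 1) ∂P) :
    P {ω | T s ω 0 < T s ω 1} * P {ω | T t ω 1 < T t ω 0} = 0 := by
  have hint : ∀ u k, Integrable (fun ω => T u ω k) P := fun u k =>
    (hT.memLp_two_eval hT1 u k).integrable one_le_two
  have hid := (hT.stationaryIncrements s t)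
  have hmin := (hid.comp (u := fun x : EuclideanSpace ℝ (Fin 2) => min (x 0) (x 1))
    (by fun_prop)).integral_eq
  simp only [Function.comp_def, PiLp.sub_apply] at hmin
  have hi1 : Integrable (fun ω => min (T (s + t) ω 0) (T (s + t) ω 1)) P :=
    (hint _ 0).inf (hint _ 1)
  have hi2 : Integrable (fun ω => min (T s ω 0) (T s ω 1)) P := (hint _ 0).inf (hint _ 1)
  have hi3 : Integrable (fun ω => min (T (s + t) ω 0 - T s ω 0) (T (s + t) ω 1 - T s ω 1)) P :=
    ((hint _ 0).sub (hint _ 0)).inf ((hint _ 1).sub (hint _ 1))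
  have hi12 : Integrable (fun ω => min (T (s + t) ω 0) (T (s + t) ω 1) -
    min (T s ω 0) (T s ω 1)) P := hi1.sub hi2
  have hi123 : Integrable (fun ω => min (T (s + t) ω 0) (T (s + t) ω 1) -
      min (T s ω 0) (T s ω 1) - min (T (s + t) ω 0 - T s ω 0) (T (s + t) ω 1 - T s ω 1)) P :=
    hi12.sub hi3
  -- The integrand is the superadditivity defect of the minimum; it is nonnegative, so a zero
  -- integral makes it vanish a.s.
  have hzero : ∫ ω, (min (T (s + t) ω 0) (T (s + t) ω 1) - min (T s ω 0) (T s ω 1) -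
      min (T (s + t) ω 0 - T s ω 0) (T (s + t) ω 1 - T s ω 1)) ∂P = 0 := by
    rw [integral_sub hi12 hi3, integral_sub hi1 hi2, hmin]
    linarith
  rw [integral_eq_zero_iff_of_nonneg_ae ?_ hi123] at hzero
  · have hind := (hT.indepFun_increment (le_self_add : s ≤ s + t)).measure_inter_preimage_eq_mul
      {x | x 0 < x 1} {x | x 1 < x 0} (measurableSet_lt (by fun_prop) (by fun_prop))
      (measurableSet_lt (by fun_prop) (by fun_prop))
    have h1 : P ((fun ω => T (s + t) ω - T s ω) ⁻¹' {x | x 1 < x 0}) =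
        P {ω | T t ω 1 < T t ω 0} :=
      hid.measure_mem_eq (s := {x | x 1 < x 0}) (measurableSet_lt (by fun_prop) (by fun_prop))
    rw [h1] at hind
    rw [Set.preimage_ofPred_eq] at hind
    rw [← hind]
    -- If a_0 < a_1 and b_1 < b_0, both coordinates of a + b exceed a_0 + b_1, so the defect is
    -- strictly positive.
    refine measure_mono_null ?_ (ae_iff.1 hzero)
    intro ω ⟨ha, hb⟩
    simp only [Set.mem_ofPred_eq, Set.mem_preimage, PiLp.sub_apply, Pi.zero_apply] at ha hb ⊢
    rw [min_eq_left ha.le, min_eq_right hb.le]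
    rcases min_choice (T (s + t) ω 0) (T (s + t) ω 1) with h | h <;> rw [h] <;> intro h' <;>
      linarith
  · refine ae_of_all _ fun ω => ?_
    have ha := min_le_left (T s ω 0) (T s ω 1)
    have hb := min_le_right (T s ω 0) (T s ω 1)
    have hc := min_le_left (T (s + t) ω 0 - T s ω 0) (T (s + t) ω 1 - T s ω 1)
    have hd := min_le_right (T (s + t) ω 0 - T s ω 0) (T (s + t) ω 1 - T s ω 1)
    have he := le_min (show min (T s ω 0) (T s ω 1) +
      min (T (s + t) ω 0 - T s ω 0) (T (s + t) ω 1 - T s ω 1) ≤ T (s + t) ω 0 by linarith)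
      (show min (T s ω 0) (T s ω 1) +
      min (T (s + t) ω 0 - T s ω 0) (T (s + t) ω 1 - T s ω 1) ≤ T (s + t) ω 1 by linarith)
    simp only [Pi.zero_apply]
    linarith

theorem IsLevyProcess.scalar_sub (hT : IsLevyProcess P T) (i j : Fin 2) :
    IsLevyProcess P (scalar fun t ω => T t ω i - T t ω j) := by
  let L : EuclideanSpace ℝ (Fin 2) →L[ℝ] EuclideanSpace ℝ (Fin 1) :=
    (ContinuousLinearMap.toSpanSingleton ℝ (!₂[(1 : ℝ)] : EuclideanSpace ℝ (Fin 1))).comp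
      (EuclideanSpace.proj i - EuclideanSpace.proj j)
  convert hT.map L using 3 with t ω
  ext k
  fin_cases k
  simp [L, scalar]

/-- One time s with P(T_1(s) < T_2(s)) > 0 forbids the opposite strict order at every t; if there is
no such s, then T_1 - T_2 is nonnegative. -/
theorem hasMonotonicComponents_of_integral_min (hT : IsLevyProcess P T) (hT1 : MemLp (T 1) 2 P)
    (hadd : ∀ s t : ℝ≥0, ∫ ω, min (T (s + t) ω 0) (T (s + t) ω 1) ∂P =
      ∫ ω, min (T s ω 0) (T s ω 1) ∂P + ∫ ω, min (T t ω 0) (T t ω 1) ∂P) :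
    HasMonotonicComponents P T := by
  by_cases h : ∃ s, P {ω | T s ω 0 < T s ω 1} ≠ 0
  · obtain ⟨s, hs⟩ := h
    refine Or.inl (isSubordinator_scalar_of_nonneg (hT.scalar_sub 1 0) fun t => ?_)
    have h := (mul_eq_zero.1 (measure_mul_measure_eq_zero hT hT1 (hadd s t))).resolve_left hs
    filter_upwards [measure_eq_zero_iff_ae_notMem.1 h] with ω hω
    simpa using hω
  · push Not at h
    refine Or.inr (isSubordinator_scalar_of_nonneg (hT.scalar_sub 0 1) fun t => ?_)
    filter_upwards [measure_eq_zero_iff_ae_notMem.1 (h t)] with ω hω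
    simpa using hω

/-- If a strongly subordinated process with correlated components has the marginals of a Lévy
process, then the subordinator has monotonic components. -/
theorem hasMonotonicComponents_of_identDistrib {Ω' : Type*} [MeasurableSpace Ω'] {Q : Measure Ω'}
    [IsProbabilityMeasure Q] {X : ℝ≥0 → Ω → EuclideanSpace ℝ (Fin 2)}
    {Y : ℝ≥0 → Ω' → EuclideanSpace ℝ (Fin 2)} (hT : IsSubordinator P T) (hX : IsLevyProcess P X)
    (hY : IsLevyProcess Q Y) (hTX : IndepFun (path T) (path X) P) (hT1 : MemLp (T 1) 2 P)
    (hX1 : MemLp (X 1) 2 P) (hcov : cov[fun ω => X 1 ω 0, fun ω => X 1 ω 1; P] ≠ 0)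
    (hid : ∀ t : ℝ≥0, 0 < t → IdentDistrib (strongSub X T t) (Y t) P Q) :
    HasMonotonicComponents P T := by
  have hY1 : MemLp (Y 1) 2 Q :=
    (hid 1 one_pos).memLp_iff.1 (memLp_strongSub hT hX hTX hT1 hX1 1)
  obtain ⟨c, hc⟩ : ∃ c : ℝ, ∀ t : ℝ≥0, ∫ ω, min (T t ω 0) (T t ω 1) ∂P = t * c := by
    -- The slope comes from solving `covariance_strongSub` for the expected minimum, which uses the
    -- nonzero covariance of X(1).
    refine ⟨(cov[fun ω => Y 1 ω 0, fun ω => Y 1 ω 1; Q] -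
      cov[fun ω => T 1 ω 0, fun ω => T 1 ω 1; P] *
        ((∫ ω, X 1 ω 0 ∂P) * ∫ ω, X 1 ω 1 ∂P)) /
      cov[fun ω => X 1 ω 0, fun ω => X 1 ω 1; P], fun t => ?_⟩
    rcases eq_or_lt_of_le (zero_le (a := t)) with rfl | ht
    · have h0 : (fun ω => min (T 0 ω 0) (T 0 ω 1)) =ᵐ[P] fun _ => 0 := by
        filter_upwards [hT.levy.zero] with ω hω
        simp [hω]
      simp [integral_congr_ae h0]
    · have h1 := covariance_strongSub hT hX hTX hT1 hX1 0 1 t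
      rw [covariance_congr_identDistrib (hid t ht), hY.covariance_eval hY1] at h1
      field_simp
      linarith
  refine hasMonotonicComponents_of_integral_min hT.levy hT1 fun s t => ?_
  rw [hc, hc, hc]
  push_cast
  ring

end MonotonicComponents

/-- At t = 1/‖a - b‖ the difference t(a - b) has norm 1, too small for a nonzero multiple of 2πi.
Varying t thus removes the ambiguity of the logarithm. -/
theorem eq_of_forall_exp_mul_eq {a b : ℂ}
    (h : ∀ t : ℝ≥0, Complex.exp ((t : ℝ) * a) = Complex.exp ((t : ℝ) * b)) : a = b := by
  by_contra hab
  have hc : 0 < ‖a - b‖ := norm_pos_iff.2 (sub_ne_zero.2 hab)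
  obtain ⟨n, hn⟩ := Complex.exp_eq_exp_iff_exists_int.1 (h ‖a - b‖₊⁻¹)
  have h1 : ((‖a - b‖⁻¹ : ℝ) : ℂ) * (a - b) = n * (2 * Real.pi * Complex.I) := by
    simp only [NNReal.coe_inv, coe_nnnorm] at hn
    rw [mul_sub, hn]
    ring
  have h2 := congrArg norm h1
  simp only [norm_mul, Complex.norm_real, norm_inv, abs_norm, Complex.norm_intCast,
    Complex.norm_I, Complex.norm_ofNat, Real.norm_eq_abs, abs_of_pos Real.pi_pos] at h2
  rw [inv_mul_cancel₀ hc.ne'] at h2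
  rcases eq_or_ne n 0 with rfl | hn0
  · simp at h2
  · have h3 : (1 : ℝ) ≤ |(n : ℝ)| := by exact_mod_cast Int.one_le_abs hn0
    have h4 := Real.pi_gt_three
    nlinarith

/-! ### Characteristic functions and independence -/

section CharFun

variable {Ω : Type*} [MeasurableSpace Ω] {P : Measure Ω}

theorem charFun_map_eq_integral {ι : Type*} [Fintype ι] {U : Ω → EuclideanSpace ℝ ι}
    (hU : AEMeasurable U P) (θ : EuclideanSpace ℝ ι) :
    charFun (P.map U) θ = ∫ ω, Complex.exp ((inner ℝ (U ω) θ : ℝ) * Complex.I) ∂P := by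
  rw [charFun_apply, integral_map hU (by fun_prop)]

/-- The components of a bivariate random vector are independent iff its characteristic function is
the product of those of the marginals. -/
theorem indepFun_iff_charFun_eq_mul [IsProbabilityMeasure P] {U : Ω → EuclideanSpace ℝ (Fin 2)}
    (hU : Measurable U) :
    IndepFun (fun ω => U ω 0) (fun ω => U ω 1) P ↔ ∀ a b : ℝ, charFun (P.map U) !₂[a, b] =
      charFun (P.map U) !₂[a, 0] * charFun (P.map U) !₂[0, b] := by
  have h0 : Measurable (fun ω => U ω 0) := by fun_prop
  have h1 : Measurable (fun ω => U ω 1) := by fun_prop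
  rw [indepFun_iff_charFun_prod h0.aemeasurable h1.aemeasurable]
  have ha : ∀ a : ℝ, charFun (P.map fun ω => U ω 0) a = charFun (P.map U) !₂[a, 0] := by
    intro a
    rw [charFun_map_eq_integral hU.aemeasurable, charFun_apply,
      integral_map h0.aemeasurable (by fun_prop)]
    simp [PiLp.inner_apply, Fin.sum_univ_two]
  have hb : ∀ b : ℝ, charFun (P.map fun ω => U ω 1) b = charFun (P.map U) !₂[0, b] := by
    intro b
    rw [charFun_map_eq_integral hU.aemeasurable, charFun_apply,
      integral_map h1.aemeasurable (by fun_prop)]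
    simp [PiLp.inner_apply, Fin.sum_univ_two]
  have hab : ∀ t : WithLp 2 (ℝ × ℝ), charFun (P.map fun ω => WithLp.toLp 2 (U ω 0, U ω 1)) t =
      charFun (P.map U) !₂[t.ofLp.1, t.ofLp.2] := by
    intro t
    rw [charFun_map_eq_integral hU.aemeasurable, charFun_apply,
      integral_map (by fun_prop) (by fun_prop)]
    simp [PiLp.inner_apply, Fin.sum_univ_two, WithLp.prod_inner_apply]
  simp only [ha, hb, hab]
  exact ⟨fun h a b => h (WithLp.toLp 2 (a, b)), fun h t => h _ _⟩

end CharFun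

/-! ### Finite variation exponents and the drift -/

section FiniteVariation

variable {ι : Type*} [Fintype ι] {ν : Measure (EuclideanSpace ℝ ι)}

theorem norm_exp_inner_sub_one_le (θ t : EuclideanSpace ℝ ι) :
    ‖Complex.exp (Complex.I * (inner ℝ θ t : ℝ)) - 1‖ ≤ 2 * max ‖θ‖ 1 * min ‖t‖ 1 := by
  have h1 : ‖Complex.exp (Complex.I * (inner ℝ θ t : ℝ)) - 1‖ ≤ ‖θ‖ * ‖t‖ :=
    (Real.norm_exp_I_mul_ofReal_sub_one_le).trans (norm_inner_le_norm θ t)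
  have h2 : ‖Complex.exp (Complex.I * (inner ℝ θ t : ℝ)) - 1‖ ≤ 2 := by
    refine (norm_sub_le _ _).trans ?_
    rw [mul_comm, Complex.norm_exp_ofReal_mul_I]
    norm_num
  have h3 := le_max_left ‖θ‖ 1
  have h4 := le_max_right ‖θ‖ 1
  have h5 := norm_nonneg t
  rcases le_total ‖t‖ 1 with h | h
  · rw [min_eq_left h]
    nlinarith
  · rw [min_eq_right h]
    linarith

theorem integrable_exp_inner_sub_one (hν : Integrable (fun t => min ‖t‖ 1) ν)
    (θ : EuclideanSpace ℝ ι) :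
    Integrable (fun t => Complex.exp (Complex.I * (inner ℝ θ t : ℝ)) - 1) ν :=
  (hν.const_mul (2 * max ‖θ‖ 1)).mono' (by fun_prop)
    (ae_of_all _ fun t => norm_exp_inner_sub_one_le θ t)

/-- The jump part of the exponent of a finite variation process is sublinear. -/
theorem tendsto_integral_exp_inner_sub_one_div (hν : Integrable (fun t => min ‖t‖ 1) ν)
    (θ : EuclideanSpace ℝ ι) :
    Tendsto (fun n : ℕ => (∫ t, (Complex.exp (Complex.I * (inner ℝ ((n : ℝ) • θ) t : ℝ)) - 1) ∂ν) /
      (n : ℂ)) atTop (𝓝 0) := by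
  have h := tendsto_integral_of_dominated_convergence (μ := ν)
    (F := fun (n : ℕ) t => (Complex.exp (Complex.I * (inner ℝ ((n : ℝ) • θ) t : ℝ)) - 1) / (n : ℂ))
    (f := fun _ => 0) (fun t => 2 * max ‖θ‖ 1 * min ‖t‖ 1) (fun n => by fun_prop)
    (hν.const_mul _) (fun n => ae_of_all _ fun t => ?_) (ae_of_all _ fun t => ?_)
  · simpa only [integral_div, integral_zero] using h
  · rw [norm_div, Complex.norm_natCast]
    -- At n = 0 division by zero gives 0; for n ≥ 1 the bound grows at most by the factor n, which
    -- the division cancels.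
    rcases Nat.eq_zero_or_pos n with rfl | hn
    · simp only [Nat.cast_zero, div_zero]
      positivity
    · have hn1 : (1 : ℝ) ≤ n := by exact_mod_cast hn
      rw [div_le_iff₀ (by positivity)]
      refine (norm_exp_inner_sub_one_le _ t).trans ?_
      have h1 : max ‖(n : ℝ) • θ‖ 1 ≤ n * max ‖θ‖ 1 := by
        rw [norm_smul, Real.norm_natCast]
        refine max_le (by gcongr; exact le_max_left _ _) ?_
        nlinarith [le_max_right ‖θ‖ 1]
      have h2 : 0 ≤ min ‖t‖ 1 := by positivity
      nlinarith
  · refine squeeze_zero_norm (a := fun n : ℕ => 2 / (n : ℝ)) (fun n => ?_)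
      (tendsto_const_div_atTop_nhds_zero_nat 2)
    rw [norm_div, Complex.norm_natCast]
    gcongr
    refine (norm_sub_le _ _).trans ?_
    rw [mul_comm, Complex.norm_exp_ofReal_mul_I]
    norm_num

end FiniteVariation

section Drift

variable {Ω : Type*} [MeasurableSpace Ω] {P : Measure Ω} {ι : Type*} [Fintype ι]
  {T : ℝ≥0 → Ω → EuclideanSpace ℝ ι} {d : EuclideanSpace ℝ ι} {ν : Measure (EuclideanSpace ℝ ι)}

/-- Finite variation controls the unit ball, and the Lévy measure has finite mass outside it. -/
theorem HasDrift.integrable_min_norm (h : HasDrift P T d ν) :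
    Integrable (fun t => min ‖t‖ 1) ν := by
  refine ⟨by fun_prop, ?_⟩
  rw [hasFiniteIntegral_iff_ofReal (ae_of_all _ fun t => by positivity),
    ← lintegral_add_compl _ (Metric.isClosed_closedBall (x := (0 : EuclideanSpace ℝ ι))
      (ε := 1)).measurableSet]
  refine ENNReal.add_lt_top.2 ⟨lt_of_le_of_lt ?_ h.finiteVariation,
    lt_of_le_of_lt ?_ h.triplet.levyMeasure.2⟩
  · exact lintegral_mono fun t => ENNReal.ofReal_le_ofReal (min_le_left _ _)
  · refine le_trans (setLIntegral_mono (by fun_prop) fun t ht => ?_) (setLIntegral_le_lintegral _ _)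
    have ht' : 1 < ‖t‖ := by simpa using ht
    rw [min_eq_right ht'.le, min_eq_right (by nlinarith)]

theorem HasDrift.integrable_id (h : HasDrift P T d ν) :
    IntegrableOn (fun t => t) (Metric.closedBall 0 1) ν := by
  refine ⟨by fun_prop, ?_⟩
  rw [hasFiniteIntegral_iff_norm]
  exact h.finiteVariation

/-- The exponent of a subordinator in terms of its drift. -/
theorem HasDrift.levyExponent_eq (h : HasDrift P T d ν) (θ : EuclideanSpace ℝ ι) :
    levyExponent (d + ∫ t in Metric.closedBall 0 1, t ∂ν) 0 ν θ =
      Complex.I * (inner ℝ d θ : ℝ) +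
        ∫ t, (Complex.exp (Complex.I * (inner ℝ θ t : ℝ)) - 1) ∂ν := by
  have hball : MeasurableSet (Metric.closedBall (0 : EuclideanSpace ℝ ι) 1) :=
    Metric.isClosed_closedBall.measurableSet
  have hind : (fun t : EuclideanSpace ℝ ι => if ‖t‖ ≤ 1 then (inner ℝ θ t : ℝ) else 0) =
      (Metric.closedBall 0 1).indicator fun t => inner ℝ θ t := by
    funext t
    simp [Set.indicator]
  have hint : Integrable (fun t : EuclideanSpace ℝ ι =>
      if ‖t‖ ≤ 1 then (inner ℝ θ t : ℝ) else 0) ν := by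
    rw [hind, integrable_indicator_iff hball]
    exact h.integrable_id.const_inner θ
  have hval : ∫ t : EuclideanSpace ℝ ι, (if ‖t‖ ≤ 1 then (inner ℝ θ t : ℝ) else 0) ∂ν =
      inner ℝ θ (∫ t in Metric.closedBall 0 1, t ∂ν) := by
    rw [hind, integral_indicator hball]
    exact integral_inner h.integrable_id θ
  have hint' : Integrable (fun t : EuclideanSpace ℝ ι =>
      Complex.I * ((if ‖t‖ ≤ 1 then (inner ℝ θ t : ℝ) else 0 : ℝ) : ℂ)) ν := hint.ofReal.const_mul _
  have hsplit := integral_sub (integrable_exp_inner_sub_one h.integrable_min_norm θ) hint'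
  rw [integral_const_mul, integral_complex_ofReal, hval] at hsplit
  rw [levyExponent, hsplit, inner_add_left,
    real_inner_comm θ (∫ t in Metric.closedBall 0 1, t ∂ν)]
  simp only [Matrix.zero_apply, mul_zero, zero_mul, Finset.sum_const_zero, Complex.ofReal_zero,
    Complex.ofReal_add]
  ring

/-- The characteristic function of a subordinator in terms of its drift. -/
theorem HasDrift.charFun_eq (h : HasDrift P T d ν) (t : ℝ≥0) (θ : EuclideanSpace ℝ ι) :
    charFun (P.map (T t)) θ = Complex.exp ((t : ℝ) * (Complex.I * (inner ℝ d θ : ℝ) +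
        ∫ t, (Complex.exp (Complex.I * (inner ℝ θ t : ℝ)) - 1) ∂ν)) := by
  rw [h.triplet.charFun_eq, h.levyExponent_eq]

/-- If a component of a subordinator is drift-less, the corresponding drift vanishes. -/
theorem HasDrift.drift_eq_zero (h : HasDrift P T d ν) (k : ι)
    (hk : IsDriftless P (scalar (component T k))) : d k = 0 := by
  classical
  obtain ⟨ν', h'⟩ := hk
  -- The exponent of T_k is computed twice: from T in the direction of the k-th axis, and from the
  -- drift-less triplet of the component.
  have hexp : ∀ u : ℝ, Complex.I * (u * d k : ℝ) +
      ∫ t, (Complex.exp (Complex.I * (inner ℝ (u • EuclideanSpace.single k (1 : ℝ)) t : ℝ)) - 1) ∂ν =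
        ∫ t, (Complex.exp (Complex.I * (inner ℝ (u • EuclideanSpace.single (0 : Fin 1) (1 : ℝ)) t : ℝ))
          - 1) ∂ν' := by
    intro u
    refine eq_of_forall_exp_mul_eq fun t => ?_
    have h1 := h.charFun_eq t (u • EuclideanSpace.single k (1 : ℝ))
    have h2 := h'.charFun_eq t (u • EuclideanSpace.single (0 : Fin 1) (1 : ℝ))
    rw [charFun_map_eq_integral (h.subordinator.levy.measurable t).aemeasurable] at h1
    rw [charFun_map_eq_integral (h'.subordinator.levy.measurable t).aemeasurable] at h2
    simp only [inner_zero_left, Complex.ofReal_zero, mul_zero, zero_add] at h2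
    rw [← h2]
    have h3 : inner ℝ d (u • EuclideanSpace.single k (1 : ℝ)) = u * d k := by
      simp [inner_smul_right, EuclideanSpace.inner_single_right]
    rw [h3] at h1
    rw [← h1]
    simp [inner_smul_right, EuclideanSpace.inner_single_right, scalar, component]
  -- With u = n and division by n, the jump parts disappear in the limit and only the drift term
  -- survives.
  have hlim := (tendsto_integral_exp_inner_sub_one_div h'.integrable_min_norm
    (EuclideanSpace.single (0 : Fin 1) (1 : ℝ))).sub
      (tendsto_integral_exp_inner_sub_one_div h.integrable_min_norm
        (EuclideanSpace.single k (1 : ℝ)))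
  have hconst : Tendsto (fun _ : ℕ => Complex.I * (d k : ℂ)) atTop (𝓝 0) := by
    rw [sub_zero] at hlim
    refine hlim.congr' ?_
    filter_upwards [eventually_gt_atTop 0] with n hn
    have hn' : (n : ℂ) ≠ 0 := by exact_mod_cast hn.ne'
    rw [← hexp n]
    push_cast
    field_simp
    ring
  have h0 := tendsto_nhds_unique tendsto_const_nhds hconst
  simpa using h0

end Drift

/-! ### Independent components: Lévy measure on the axes -/

section Axes

variable {Ω : Type*} [MeasurableSpace Ω] {P : Measure Ω} [IsProbabilityMeasure P]
  {T : ℝ≥0 → Ω → EuclideanSpace ℝ (Fin 2)} {d : EuclideanSpace ℝ (Fin 2)}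
  {ν : Measure (EuclideanSpace ℝ (Fin 2))}

/-- The Lévy measure of a bivariate subordinator with independent components is concentrated on the
coordinate axes. -/
theorem HasDrift.ae_eq_zero_or_eq_zero (h : HasDrift P T d ν)
    (hind : ∀ t, IndepFun (fun ω => T t ω 0) (fun ω => T t ω 1) P) :
    ∀ᵐ t ∂ν, t 0 = 0 ∨ t 1 = 0 := by
  let F : EuclideanSpace ℝ (Fin 2) → ℂ :=
    fun θ => ∫ t, (Complex.exp (Complex.I * (inner ℝ θ t : ℝ)) - 1) ∂ν
  have hF : ∀ a b : ℝ, F !₂[a, b] = F !₂[a, 0] + F !₂[0, b] := by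
    intro a b
    have h1 := eq_of_forall_exp_mul_eq (a := Complex.I * (inner ℝ d !₂[a, b] : ℝ) + F !₂[a, b])
      (b := (Complex.I * (inner ℝ d !₂[a, 0] : ℝ) + F !₂[a, 0]) +
        (Complex.I * (inner ℝ d !₂[0, b] : ℝ) + F !₂[0, b])) fun t => by
      rw [mul_add ((t : ℝ) : ℂ) (_ + _), Complex.exp_add, ← h.charFun_eq, ← h.charFun_eq,
        ← h.charFun_eq]
      exact (indepFun_iff_charFun_eq_mul (h.subordinator.levy.measurable t)).1 (hind t) a b
    simp only [PiLp.inner_apply, Fin.sum_univ_two] at h1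
    simp at h1
    linear_combination h1
  obtain ⟨G, hG⟩ : ∃ G : ℝ → ℝ → EuclideanSpace ℝ (Fin 2) → ℝ,
      ∀ a b t, G a b t = Real.cos (a * t 0 + b * t 1) - 1 := ⟨_, fun _ _ _ => rfl⟩
  have hGint : ∀ a b : ℝ, Integrable (G a b) ν ∧ (F !₂[a, b]).re = ∫ t, G a b t ∂ν := by
    intro a b
    have hi := integrable_exp_inner_sub_one h.integrable_min_norm !₂[a, b]
    have heq : ∀ t : EuclideanSpace ℝ (Fin 2),
        (Complex.exp (Complex.I * (inner ℝ !₂[a, b] t : ℝ)) - 1).re = G a b t := by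
      intro t
      rw [hG, mul_comm Complex.I, Complex.sub_re, Complex.exp_ofReal_mul_I_re, Complex.one_re]
      simp [PiLp.inner_apply, Fin.sum_univ_two, mul_comm]
    constructor
    · simpa [heq] using hi.re
    · have := integral_re hi
      simp only [RCLike.re_to_complex, heq] at this
      exact this.symm
  -- Adding the relations for (a, a) and (a, -a) and taking real parts gives zero integral for 2(1 -
  -- cos(a t_0))(1 - cos(a t_1)) ≥ 0.
  have hprod : ∀ a : ℝ, ∀ᵐ t ∂ν, (1 - Real.cos (a * t 0)) * (1 - Real.cos (a * t 1)) = 0 := by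
    intro a
    have h1 := congrArg Complex.re (hF a a)
    have h2 := congrArg Complex.re (hF a (-a))
    rw [Complex.add_re, (hGint _ _).2, (hGint _ _).2, (hGint _ _).2] at h1 h2
    have hi := fun b c => (hGint b c).1
    have hsum : ∫ t, (G a a + G a (-a) - (G a 0 + G a 0) - (G 0 a + G 0 (-a))) t ∂ν = 0 := by
      rw [integral_sub' (((hi _ _).add (hi _ _)).sub ((hi _ _).add (hi _ _)))
        ((hi _ _).add (hi _ _)), integral_sub' ((hi _ _).add (hi _ _)) ((hi _ _).add (hi _ _)),
        integral_add' (hi _ _) (hi _ _), integral_add' (hi _ _) (hi _ _),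
        integral_add' (hi _ _) (hi _ _), h1, h2]
      ring
    have hpt : ∀ t, (G a a + G a (-a) - (G a 0 + G a 0) - (G 0 a + G 0 (-a))) t =
        2 * ((1 - Real.cos (a * t 0)) * (1 - Real.cos (a * t 1))) := by
      intro t
      simp only [Pi.add_apply, Pi.sub_apply, hG, zero_mul, zero_add, add_zero, neg_mul,
        Real.cos_neg, Real.cos_add, Real.sin_neg]
      ring
    rw [integral_eq_zero_iff_of_nonneg (fun t => ?_) ((((hi _ _).add (hi _ _)).sub
      ((hi _ _).add (hi _ _))).sub ((hi _ _).add (hi _ _)))] at hsum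
    · filter_upwards [hsum] with t ht
      rw [hpt] at ht
      simpa using ht
    · rw [hpt]
      exact mul_nonneg zero_le_two (mul_nonneg (sub_nonneg.2 (Real.cos_le_one _))
        (sub_nonneg.2 (Real.cos_le_one _)))
  -- Countably many frequencies tending to 0 suffice: once |a x| < 1 with a x ≠ 0, the cosine
  -- differs from 1.
  filter_upwards [ae_all_iff.2 fun n : ℕ => hprod (1 / ((n : ℝ) + 1))] with t ht
  by_contra! hne
  have hsmall : ∀ x : ℝ, ∀ᶠ n : ℕ in atTop, |1 / ((n : ℝ) + 1) * x| < 1 := by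
    intro x
    have hx : Tendsto (fun n : ℕ => |1 / ((n : ℝ) + 1) * x|) atTop (𝓝 0) := by
      simpa using ((tendsto_one_div_add_atTop_nhds_zero_nat (𝕜 := ℝ)).mul_const x).abs
    exact hx.eventually_lt_const one_pos
  obtain ⟨n, hn0, hn1⟩ := ((hsmall (t 0)).and (hsmall (t 1))).exists
  have hcos : ∀ x : ℝ, x ≠ 0 → |1 / ((n : ℝ) + 1) * x| < 1 →
      1 - Real.cos (1 / ((n : ℝ) + 1) * x) ≠ 0 := by
    intro x hx h1 h2
    have h3 : 1 / ((n : ℝ) + 1) * x ≠ 0 := mul_ne_zero (by positivity) hx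
    have h4 := Real.pi_gt_three
    rw [abs_lt] at h1
    exact h3 ((Real.cos_eq_one_iff_of_lt_of_lt (by linarith) (by linarith)).1 (by linarith))
  exact mul_ne_zero (hcos _ hne.1 hn0) (hcos _ hne.2 hn1) (ht n)

end Axes

/-! ### From independence at fixed times to independent processes -/

section ComponentProcesses

variable {Ω : Type*} [MeasurableSpace Ω] {P : Measure Ω} [IsProbabilityMeasure P]

theorem iIndepFun_fin_two_of_indepFun {β : Type*} [MeasurableSpace β] {f : Fin 2 → Ω → β}
    (h : IndepFun (f 0) (f 1) P) : iIndepFun f P := by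
  rw [iIndepFun_iff_measure_inter_preimage_eq_mul]
  intro S sets hsets
  have hS : ∀ S : Finset (Fin 2), S = ∅ ∨ S = {0} ∨ S = {1} ∨ S = {0, 1} := by decide
  rcases hS S with rfl | rfl | rfl | rfl
  · simp
  · simp
  · simp
  · simpa using h.measure_inter_preimage_eq_mul _ _ (hsets 0 (by simp)) (hsets 1 (by simp))

/-- Finitely many times are contained in the range of a monotone sequence started at `0`. -/
theorem exists_monotone_seq (K : Finset ℝ≥0) :
    ∃ t : ℕ → ℝ≥0, Monotone t ∧ t 0 = 0 ∧ ∀ s ∈ K, ∃ n, t n = s := by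
  classical
  have hK : 0 < (insert 0 K).card := Finset.card_pos.2 (Finset.insert_nonempty 0 K)
  let e := (insert 0 K).orderEmbOfFin rfl
  -- The sorted enumeration of the times with 0 adjoined, frozen at its last value.
  refine ⟨fun n => e ⟨min n ((insert 0 K).card - 1), by omega⟩, fun m n hmn => ?_, ?_, ?_⟩
  · exact e.monotone (Fin.mk_le_mk.2 (by omega))
  · have h0 : (0 : ℝ≥0) ∈ Set.range e := by simp [e]
    obtain ⟨i, hi⟩ := h0
    refine le_antisymm ?_ zero_le
    exact (e.monotone (a := ⟨_, _⟩) (Fin.mk_le_mk.2 (by simp))).trans hi.le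
  · intro s hs
    have h0 : s ∈ Set.range e := by simp [e, hs]
    obtain ⟨i, hi⟩ := h0
    exact ⟨i, (congrArg e (Fin.ext (Nat.min_eq_left (by omega)))).trans hi⟩

/-- If the components of a bivariate Lévy process are independent at each fixed time, they are
independent processes. -/
theorem IsLevyProcess.indepFun_component {X : ℝ≥0 → Ω → EuclideanSpace ℝ (Fin 2)}
    (hX : IsLevyProcess P X) (h : ∀ t, IndepFun (fun ω => X t ω 0) (fun ω => X t ω 1) P) :
    IndepFun (path (component X 0)) (path (component X 1)) P := by
  classical
  have hm : ∀ t k, Measurable (fun ω => X t ω k) := fun t k =>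
    (EuclideanSpace.proj (𝕜 := ℝ) k).continuous.measurable.comp (hX.measurable t)
  refine IndepFun.process_indepFun_process (X := component X 0) (Y := component X 1)
    (fun t => hm t 0) (fun t => hm t 1) fun I J => ?_
  obtain ⟨t, ht, ht0, hK⟩ := exists_monotone_seq (I ∪ J)
  let W : ℕ → Fin 2 → Ω → ℝ := fun i k ω => X (t (i + 1)) ω k - X (t i) ω k
  have hW : ∀ i k, Measurable (W i k) := fun i k => (hm _ k).sub (hm _ k)
  have hrow : iIndepFun (fun i ω k => W i k ω) P := by
    have h1 := (hX.indepIncrements.nat ht).comp (fun _ (x : EuclideanSpace ℝ (Fin 2)) k => x k)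
      (fun _ => by fun_prop)
    exact h1
  -- Rows are independent increments; within a row the two entries have the joint law of X at one
  -- fixed time. So the whole array is independent and splits into columns.
  have hall : iIndepFun (fun (p : ℕ × Fin 2) ω => W p.1 p.2 ω) P := by
    refine iIndepFun_uncurry' hW hrow fun i => iIndepFun_fin_two_of_indepFun ?_
    have hid := (hX.identDistrib_increment (ht (Nat.le_succ i))).symm
    have h1 := indepFun_iff_map_prod_eq_prod_map_map (μ := P) (hm (t (i + 1) - t i) 0).aemeasurable
      (hm (t (i + 1) - t i) 1).aemeasurable
    have h2 := h1.1 (h _)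
    rw [indepFun_iff_map_prod_eq_prod_map_map (hW i 0).aemeasurable (hW i 1).aemeasurable]
    have e0 := (hid.comp (u := fun x : EuclideanSpace ℝ (Fin 2) => x 0) (by fun_prop)).map_eq
    have e1 := (hid.comp (u := fun x : EuclideanSpace ℝ (Fin 2) => x 1) (by fun_prop)).map_eq
    have e := (hid.comp (u := fun x : EuclideanSpace ℝ (Fin 2) => (x 0, x 1)) (by fun_prop)).map_eq
    simp only [Function.comp_def] at e0 e1 e
    rw [e0, e1, e] at h2
    exact h2
  have hseq : IndepFun (fun ω i => W i 0 ω) (fun ω i => W i 1 ω) P := by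
    refine IndepFun.process_indepFun_process (fun i => hW i 0) (fun i => hW i 1) fun I' J' => ?_
    have hdisj : Disjoint (I' ×ˢ ({0} : Finset (Fin 2))) (J' ×ˢ ({1} : Finset (Fin 2))) := by
      rw [Finset.disjoint_product]
      exact Or.inr (by simp)
    have h1 := hall.indepFun_finset _ _ hdisj fun p => hW p.1 p.2
    exact h1.comp
      (φ := fun (w : ↥(I' ×ˢ ({0} : Finset (Fin 2))) → ℝ) (i : I') => w ⟨(i, 0), by simp⟩)
      (ψ := fun (w : ↥(J' ×ˢ ({1} : Finset (Fin 2))) → ℝ) (i : J') => w ⟨(i, 1), by simp⟩)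
      (by fun_prop) (by fun_prop)
  choose! n hn using hK
  -- Telescoping recovers the values of the process from a column, since X(0) = 0 a.s.
  have hsum : ∀ k : Fin 2, ∀ᵐ ω ∂P, ∀ s ∈ I ∪ J,
      ∑ i ∈ Finset.range (n s), W i k ω = component X k s ω := by
    intro k
    filter_upwards [hX.zero] with ω h0 s hs
    simp only [W, component]
    rw [Finset.sum_range_sub (fun i => X (t i) ω k), hn s hs, ht0, h0]
    simp
  have hres := hseq.comp (φ := fun w (s : I) => ∑ i ∈ Finset.range (n s), w i)
    (ψ := fun w (s : J) => ∑ i ∈ Finset.range (n s), w i) (by fun_prop) (by fun_prop)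
  refine hres.congr ?_ ?_
  · filter_upwards [hsum 0] with ω hω
    funext s
    exact hω s (Finset.mem_union_left _ s.2)
  · filter_upwards [hsum 1] with ω hω
    funext s
    exact hω s (Finset.mem_union_right _ s.2)

end ComponentProcesses

/-! ### Exponents under weak subordination -/

section LevyIntegrand

variable {ι : Type*} [Fintype ι] {ν : Measure (EuclideanSpace ℝ ι)}

theorem norm_exp_sub_one_sub_le (x : ℝ) :
    ‖Complex.exp (Complex.I * x) - 1 - Complex.I * x‖ ≤ 3 * x ^ 2 := by
  rcases le_total |x| 1 with h | h
  · have h1 := Complex.norm_exp_sub_one_sub_id_le (x := Complex.I * x) (by simpa using h)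
    refine h1.trans ?_
    simp only [norm_mul, Complex.norm_I, Complex.norm_real, one_mul, Real.norm_eq_abs, sq_abs]
    nlinarith [sq_nonneg x]
  · have h1 : ‖Complex.exp (Complex.I * x) - 1‖ ≤ |x| := Real.norm_exp_I_mul_ofReal_sub_one_le
    refine (norm_sub_le _ _).trans ?_
    simp only [norm_mul, Complex.norm_I, Complex.norm_real, one_mul, Real.norm_eq_abs]
    nlinarith [sq_abs x]

/-- The integrand of the Lévy exponent. -/
def levyIntegrand (θ x : EuclideanSpace ℝ ι) : ℂ :=
  Complex.exp (Complex.I * (inner ℝ θ x : ℝ)) - 1 -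
      Complex.I * (if ‖x‖ ≤ 1 then (inner ℝ θ x : ℝ) else 0 : ℝ)

theorem integrable_levyIntegrand (hν : IsLevyMeasure ν) (θ : EuclideanSpace ℝ ι) :
    Integrable (levyIntegrand θ) ν := by
  have hmin : Integrable (fun x => min (‖x‖ ^ 2) 1) ν := by
    refine ⟨by fun_prop, ?_⟩
    rw [hasFiniteIntegral_iff_ofReal (ae_of_all _ fun t => by positivity)]
    exact hν.2
  have hmeas : Measurable (levyIntegrand θ) := by
    have h1 : Measurable (fun x : EuclideanSpace ℝ ι =>
        if ‖x‖ ≤ 1 then (inner ℝ θ x : ℝ) else 0) :=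
      Measurable.ite (measurableSet_le (by fun_prop) (by fun_prop)) (by fun_prop) (by fun_prop)
    unfold levyIntegrand
    fun_prop
  -- The quadratic estimate serves inside the unit ball, the trivial bound 2 outside.
  refine (hmin.const_mul (3 * ‖θ‖ ^ 2 + 2)).mono' hmeas.aestronglyMeasurable
    (ae_of_all _ fun x => ?_)
  have hin := abs_real_inner_le_norm θ x
  unfold levyIntegrand
  split_ifs with hx
  · refine (norm_exp_sub_one_sub_le _).trans ?_
    rw [min_eq_left (by nlinarith [norm_nonneg x])]
    have h1 : (inner ℝ θ x) ^ 2 ≤ (‖θ‖ * ‖x‖) ^ 2 := by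
      rw [← sq_abs]
      gcongr
    nlinarith [sq_nonneg ‖x‖]
  · push Not at hx
    rw [min_eq_right (by nlinarith), Complex.ofReal_zero, mul_zero, sub_zero]
    refine (norm_sub_le _ _).trans ?_
    rw [mul_comm, Complex.norm_exp_ofReal_mul_I]
    norm_num

theorem levyExponent_zero_covariance (m θ : EuclideanSpace ℝ ι) :
    levyExponent m 0 ν θ = Complex.I * (inner ℝ m θ : ℝ) + ∫ x, levyIntegrand θ x ∂ν := by
  simp [levyExponent, levyIntegrand]

end LevyIntegrand

section WeakExponent

variable {Ω Ω' : Type*} [MeasurableSpace Ω] [MeasurableSpace Ω'] {P : Measure Ω}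
  [IsProbabilityMeasure P] {R : Measure Ω'} [IsProbabilityMeasure R]
  {T X : ℝ≥0 → Ω → EuclideanSpace ℝ (Fin 2)}
  {Z : ℝ≥0 → Ω' → EuclideanSpace ℝ (Fin 2 ⊕ Fin 2)}

theorem weakCov_zero {n : ℕ} (S : Matrix (Fin n) (Fin n) ℝ) : weakCov 0 S = 0 := by
  have h : outerMatrix 0 S = 0 := by
    ext k l
    simp [outerMatrix]
  rw [weakCov, h, Matrix.fromBlocks_zero]

theorem outerMeasure_zero {n : ℕ} (ν : Measure (EuclideanSpace ℝ (Fin n))) :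
    outerMeasure 0 ν = 0 := by
  simp [outerMeasure, spacing]

/-- If the Lévy measure of the subordinator is concentrated on the axes and there is no drift, then
at most one component of the subordinated process jumps at a time. -/
theorem ae_weakLevyMeasure {ν ν' : Measure (EuclideanSpace ℝ (Fin 2))}
    (hX : ∀ᵐ ω ∂P, X 0 ω = 0) (hν : ∀ᵐ t ∂ν, t 0 = 0 ∨ t 1 = 0) :
    ∀ᵐ z ∂(weakLevyMeasure P X 0 ν ν'), z (Sum.inr 0) = 0 ∨ z (Sum.inr 1) = 0 := by
  rw [weakLevyMeasure, outerMeasure_zero, Measure.map_zero, zero_add]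
  by_cases hf : AEMeasurable (fun p : EuclideanSpace ℝ (Fin 2) × Ω =>
    pair p.1 (multiTime X p.1 p.2)) ((ν.restrict (orthant (Fin 2))).prod P)
  · rw [ae_map_iff hf]
    · filter_upwards [Measure.quasiMeasurePreserving_fst.ae (ae_restrict_of_ae hν),
        Measure.quasiMeasurePreserving_snd.ae hX] with p h1 h2
      rcases h1 with h1 | h1
      · exact Or.inl (by simp [pair, multiTime, h1, h2])
      · exact Or.inr (by simp [pair, multiTime, h1, h2])
    · exact (measurableSet_eq_fun (by fun_prop) (by fun_prop)).union
        (measurableSet_eq_fun (by fun_prop) (by fun_prop))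
  -- Without measurability the image measure is 0 by default.
  · rw [Measure.map_of_not_aemeasurable hf]
    simp

theorem charFun_second {n : ℕ} {Z : ℝ≥0 → Ω' → EuclideanSpace ℝ (Fin n ⊕ Fin n)} {t : ℝ≥0}
    (hZ : Measurable (Z t)) (θ : EuclideanSpace ℝ (Fin n)) :
    charFun (R.map (second Z t)) θ = charFun (R.map (Z t)) (pair 0 θ) := by
  have h2 : Measurable (second Z t) := by
    unfold second
    fun_prop
  rw [charFun_map_eq_integral h2.aemeasurable, charFun_map_eq_integral hZ.aemeasurable]
  simp [PiLp.inner_apply, second, pair]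

/-- Weak subordination by a drift-less subordinator with independent components produces independent
components. -/
theorem IsWeakSubordination.charFun_second_eq_mul (h : IsWeakSubordination P T X R Z)
    (hind : ∀ t, IndepFun (fun ω => T t ω 0) (fun ω => T t ω 1) P)
    (hdrift : ∀ k, IsDriftless P (scalar (component T k))) (t : ℝ≥0) (a b : ℝ) :
    charFun (R.map (second Z t)) !₂[a, b] =
      charFun (R.map (second Z t)) !₂[a, 0] * charFun (R.map (second Z t)) !₂[0, b] := by
  obtain ⟨d, ν, μ, S, ν', hT, hX, hZ⟩ := h
  have hd : d = 0 := by
    ext k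
    exact hT.drift_eq_zero k (hdrift k)
  subst hd
  have hae := ae_weakLevyMeasure (ν' := ν') hX.levy.zero (hT.ae_eq_zero_or_eq_zero hind)
  have hZm := hZ.levy.measurable t
  simp only [charFun_second hZm, hZ.charFun_eq]
  rw [← Complex.exp_add, ← mul_add]
  congr 2
  simp only [weakCov_zero, levyExponent_zero_covariance]
  -- Where one coordinate of the second block vanishes, one summand is 0 and the other equals the
  -- left integrand.
  have hint : ∫ z, levyIntegrand (pair 0 !₂[a, b]) z ∂(weakLevyMeasure P X 0 ν ν') =
      ∫ z, levyIntegrand (pair 0 !₂[a, 0]) z ∂(weakLevyMeasure P X 0 ν ν') +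
        ∫ z, levyIntegrand (pair 0 !₂[0, b]) z ∂(weakLevyMeasure P X 0 ν ν') := by
    rw [← integral_add (integrable_levyIntegrand hZ.levyMeasure _)
      (integrable_levyIntegrand hZ.levyMeasure _)]
    refine integral_congr_ae ?_
    filter_upwards [hae] with z hz
    rcases hz with hz | hz <;>
      simp [levyIntegrand, PiLp.inner_apply, pair, Fin.sum_univ_two, hz]
  rw [hint]
  simp only [PiLp.inner_apply, Fintype.sum_sum_type, pair, Fin.sum_univ_two]
  simp
  ring

end WeakExponent

/-! ### Case (ii): symmetric subordinates -/

section RealExponent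

variable {Ω : Type*} [MeasurableSpace Ω] {P : Measure Ω} [IsProbabilityMeasure P]

/-- A symmetric Lévy process has a real characteristic exponent. -/
theorem HasTriplet.exists_real_exponent {ι : Type*} [Fintype ι]
    {X : ℝ≥0 → Ω → EuclideanSpace ℝ ι} {μ : EuclideanSpace ℝ ι} {S : Matrix ι ι ℝ}
    {ν : Measure (EuclideanSpace ℝ ι)} (hX : HasTriplet P X μ S ν)
    (hsymm : IdentDistrib (path X) (path fun t ω => -X t ω) P P) :
    ∃ g : EuclideanSpace ℝ ι → ℝ, ∀ (t : ℝ≥0) θ,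
      charFun (P.map (X t)) θ = (Real.exp (t * g θ) : ℂ) := by
  have hsymm_t : ∀ t, P.map (X t) = P.map (fun ω => -X t ω) := fun t =>
    (hsymm.comp (u := fun f : ℝ≥0 → EuclideanSpace ℝ ι => f t)
      (measurable_pi_apply (X := fun _ : ℝ≥0 => EuclideanSpace ℝ ι) t)).map_eq
  refine ⟨fun θ => (levyExponent μ S ν θ).re, fun t θ => ?_⟩
  -- At one time symmetry would only place the imaginary part in πℤ; using all times makes the
  -- exponent real.
  have hconj : (starRingEnd ℂ) (levyExponent μ S ν θ) = levyExponent μ S ν θ := by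
    refine eq_of_forall_exp_mul_eq fun s => ?_
    rw [← hX.charFun_eq, ← Complex.conj_ofReal, ← map_mul, Complex.exp_conj, ← hX.charFun_eq,
      ← charFun_neg]
    conv_rhs => rw [hsymm_t]
    have hneg : Measurable (fun ω => -X s ω) := (hX.levy.measurable s).neg
    rw [charFun_map_eq_integral (hX.levy.measurable s).aemeasurable,
      charFun_map_eq_integral hneg.aemeasurable]
    simp
  rw [hX.charFun_eq]
  push_cast
  rw [Complex.conj_eq_iff_re.1 hconj]

/-- Splits a two-time evaluation at the earlier time: with a suitable η, only the component still
running contributes afterwards. -/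
theorem IsLevyProcess.integral_exp_increment {ι : Type*} [Fintype ι]
    {X : ℝ≥0 → Ω → EuclideanSpace ℝ ι} (hX : IsLevyProcess P X) {s u : ℝ≥0} (hsu : s ≤ u)
    (θ η : EuclideanSpace ℝ ι) :
    ∫ ω, Complex.exp ((inner ℝ (X s ω) θ + inner ℝ (X u ω - X s ω) η : ℝ) * Complex.I) ∂P =
      charFun (P.map (X s)) θ * charFun (P.map (X (u - s))) η := by
  have hinc := hX.identDistrib_increment hsu
  rw [← hinc.map_eq, charFun_map_eq_integral (hX.measurable s).aemeasurable,
    charFun_map_eq_integral hinc.aemeasurable_fst]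
  have hind := (hX.indepFun_increment hsu).comp
    (φ := fun x => Complex.exp ((inner ℝ x θ : ℝ) * Complex.I))
    (ψ := fun x => Complex.exp ((inner ℝ x η : ℝ) * Complex.I)) (by fun_prop) (by fun_prop)
  have hs := hX.measurable s
  have hu := hX.measurable u
  have h := hind.integral_fun_mul_eq_mul_integral
    (Measurable.aestronglyMeasurable (by fun_prop)) (Measurable.aestronglyMeasurable (by fun_prop))
  simp only [Function.comp_apply] at h
  rw [← h]
  simp only [Complex.ofReal_add, add_mul, Complex.exp_add]

variable {X T : ℝ≥0 → Ω → EuclideanSpace ℝ (Fin 2)}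

/-- The characteristic function of `(X₁(t₁), X₂(t₂))` for a real exponent. -/
theorem IsLevyProcess.charFun_multiTime (hX : IsLevyProcess P X) {g : EuclideanSpace ℝ (Fin 2) → ℝ}
    (hg : ∀ (t : ℝ≥0) θ, charFun (P.map (X t)) θ = (Real.exp (t * g θ) : ℂ))
    {τ : EuclideanSpace ℝ (Fin 2)} (hτ : ∀ k, 0 ≤ τ k) (a b : ℝ) :
    ∫ ω, Complex.exp ((inner ℝ (multiTime X τ ω) !₂[a, b] : ℝ) * Complex.I) ∂P =
      (Real.exp (min (τ 0) (τ 1) * g !₂[a, b] + (τ 0 - min (τ 0) (τ 1)) * g !₂[a, 0] +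
        (τ 1 - min (τ 0) (τ 1)) * g !₂[0, b]) : ℂ) := by
  rcases le_total (τ 0) (τ 1) with h | h
  · have h1 := hX.integral_exp_increment (Real.toNNReal_le_toNNReal h) !₂[a, b] !₂[0, b]
    rw [hg, hg, ← Complex.ofReal_mul, ← Real.exp_add, NNReal.coe_sub (Real.toNNReal_le_toNNReal h),
      Real.coe_toNNReal _ (hτ 0), Real.coe_toNNReal _ (hτ 1)] at h1
    rw [min_eq_left h, sub_self, zero_mul, add_zero, ← h1]
    refine integral_congr_ae (ae_of_all _ fun ω => ?_)
    simp only [multiTime, PiLp.inner_apply, Fin.sum_univ_two]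
    congr 3
    simp
    ring
  · have h1 := hX.integral_exp_increment (Real.toNNReal_le_toNNReal h) !₂[a, b] !₂[a, 0]
    rw [hg, hg, ← Complex.ofReal_mul, ← Real.exp_add, NNReal.coe_sub (Real.toNNReal_le_toNNReal h),
      Real.coe_toNNReal _ (hτ 0), Real.coe_toNNReal _ (hτ 1)] at h1
    rw [min_eq_right h, sub_self, zero_mul, add_zero, ← h1]
    refine integral_congr_ae (ae_of_all _ fun ω => ?_)
    simp only [multiTime, PiLp.inner_apply, Fin.sum_univ_two]
    congr 3
    simp
    ring

/-- The characteristic function of a strongly subordinated process for a real exponent. -/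
theorem charFun_strongSub (hT : IsSubordinator P T) (hX : IsLevyProcess P X)
    (hTX : IndepFun (path T) (path X) P) {g : EuclideanSpace ℝ (Fin 2) → ℝ}
    (hg : ∀ (t : ℝ≥0) θ, charFun (P.map (X t)) θ = (Real.exp (t * g θ) : ℂ)) (t : ℝ≥0) (a b : ℝ) :
    charFun (P.map (strongSub X T t)) !₂[a, b] =
      ((∫ ω, Real.exp (min (T t ω 0) (T t ω 1) * g !₂[a, b] +
        (T t ω 0 - min (T t ω 0) (T t ω 1)) * g !₂[a, 0] +
        (T t ω 1 - min (T t ω 0) (T t ω 1)) * g !₂[0, b]) ∂P : ℝ) : ℂ) := by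
  have hm := (hT.levy.measurable t).aemeasurable (μ := P)
  have : IsProbabilityMeasure (P.map (T t)) := Measure.isProbabilityMeasure_map hm
  have haem := hX.aemeasurable_multiTime (P.map (T t))
  rw [← (identDistrib_strongSub hT hX hTX t).map_eq, charFun_map_eq_integral haem,
    integral_prod, ← integral_complex_ofReal]
  · have hae : ∀ᵐ τ ∂(P.map (T t)), ∫ ω, Complex.exp ((inner ℝ (multiTime X τ ω) !₂[a, b] : ℝ) *
        Complex.I) ∂P = (Real.exp (min (τ 0) (τ 1) * g !₂[a, b] +
        (τ 0 - min (τ 0) (τ 1)) * g !₂[a, 0] + (τ 1 - min (τ 0) (τ 1)) * g !₂[0, b]) : ℂ) := by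
      filter_upwards [hT.ae_map_nonneg t] with τ hτ using hX.charFun_multiTime hg hτ a b
    rw [integral_congr_ae hae, integral_map hm (by fun_prop)]
  · refine Integrable.of_bound (AEMeasurable.aestronglyMeasurable (by fun_prop)) 1
      (ae_of_all _ fun p => ?_)
    rw [Complex.norm_exp_ofReal_mul_I]

/-- If the components of a strongly subordinated process are independent for a subordinator with
independent components, then the exponent of the subordinate is additive. -/
theorem exponent_eq_add (hT : IsSubordinator P T) (hX : IsLevyProcess P X)
    (hTX : IndepFun (path T) (path X) P) {g : EuclideanSpace ℝ (Fin 2) → ℝ}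
    (hg : ∀ (t : ℝ≥0) θ, charFun (P.map (X t)) θ = (Real.exp (t * g θ) : ℂ)) {t : ℝ≥0}
    (hind : IndepFun (fun ω => T t ω 0) (fun ω => T t ω 1) P)
    (hpos : ¬ ∀ᵐ ω ∂P, min (T t ω 0) (T t ω 1) = 0) {a b : ℝ}
    (hmul : charFun (P.map (strongSub X T t)) !₂[a, b] =
      charFun (P.map (strongSub X T t)) !₂[a, 0] * charFun (P.map (strongSub X T t)) !₂[0, b]) :
    g !₂[a, b] = g !₂[a, 0] + g !₂[0, b] := by
  have hTm := hT.levy.measurable t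
  have hg0 : g !₂[0, 0] = 0 := by
    have h1 := hg 1 !₂[0, 0]
    have h2 : (!₂[0, 0] : EuclideanSpace ℝ (Fin 2)) = 0 := by
      ext i
      fin_cases i <;> rfl
    have : IsProbabilityMeasure (P.map (X 1)) :=
      Measure.isProbabilityMeasure_map (hX.measurable 1).aemeasurable
    rw [h2, charFun_zero] at h1
    rw [h2]
    simp only [probReal_univ, NNReal.coe_one, one_mul] at h1
    exact (Real.exp_eq_one_iff _).1 (by exact_mod_cast h1.symm)
  have hgneg : ∀ θ, g θ ≤ 0 := by
    intro θ
    have : IsProbabilityMeasure (P.map (X 1)) :=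
      Measure.isProbabilityMeasure_map (hX.measurable 1).aemeasurable
    have h1 := norm_charFun_le_one (μ := P.map (X 1)) θ
    rw [hg, Complex.norm_real, Real.norm_eq_abs, Real.abs_exp, NNReal.coe_one, one_mul] at h1
    exact Real.exp_le_one_iff.1 h1
  rw [charFun_strongSub hT hX hTX hg, charFun_strongSub hT hX hTX hg,
    charFun_strongSub hT hX hTX hg, hg0, ← Complex.ofReal_mul, Complex.ofReal_inj] at hmul
  have hexp := (hind.comp (φ := fun x => Real.exp (x * g !₂[a, 0]))
    (ψ := fun x => Real.exp (x * g !₂[0, b])) (by fun_prop)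
      (by fun_prop)).integral_fun_mul_eq_mul_integral
        (Measurable.aestronglyMeasurable (by fun_prop))
        (Measurable.aestronglyMeasurable (by fun_prop))
  simp only [Function.comp_apply, ← Real.exp_add] at hexp
  -- On the axes the minimum cancels because g vanishes at the origin.
  have hsimp : ∀ m x p q : ℝ, m * p + (x - m) * p + (q - m) * 0 = x * p := fun m x p q => by ring
  have hsimp' : ∀ m x p q : ℝ, m * p + (q - m) * 0 + (x - m) * p = x * p := fun m x p q => by ring
  simp only [hsimp, hsimp'] at hmul
  rw [← hexp] at hmul
  set G := g !₂[a, b] with hG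
  set A := g !₂[a, 0] with hA
  set B := g !₂[0, b] with hB
  have hnn := hT.ae_nonneg
  have hi1 : Integrable (fun ω => Real.exp (min (T t ω 0) (T t ω 1) * G +
      (T t ω 0 - min (T t ω 0) (T t ω 1)) * A + (T t ω 1 - min (T t ω 0) (T t ω 1)) * B)) P := by
    refine Integrable.of_bound (Measurable.aestronglyMeasurable (by fun_prop)) 1 ?_
    filter_upwards [hnn] with ω hω
    rw [Real.norm_eq_abs, Real.abs_exp, Real.exp_le_one_iff]
    have h1 := mul_nonpos_of_nonneg_of_nonpos (le_min (hω t 0) (hω t 1)) (hgneg !₂[a, b])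
    have h2 := mul_nonpos_of_nonneg_of_nonpos
      (sub_nonneg.2 (min_le_left (T t ω 0) (T t ω 1))) (hgneg !₂[a, 0])
    have h3 := mul_nonpos_of_nonneg_of_nonpos
      (sub_nonneg.2 (min_le_right (T t ω 0) (T t ω 1))) (hgneg !₂[0, b])
    linarith
  have hi2 : Integrable (fun ω => Real.exp (T t ω 0 * A + T t ω 1 * B)) P := by
    refine Integrable.of_bound (Measurable.aestronglyMeasurable (by fun_prop)) 1 ?_
    filter_upwards [hnn] with ω hω
    rw [Real.norm_eq_abs, Real.abs_exp, Real.exp_le_one_iff]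
    have h2 := mul_nonpos_of_nonneg_of_nonpos (hω t 0) (hgneg !₂[a, 0])
    have h3 := mul_nonpos_of_nonneg_of_nonpos (hω t 1) (hgneg !₂[0, b])
    linarith
  -- The exponents differ by the minimum times G - (A + B), of constant sign; equal integrals of
  -- ordered functions force a.s. equality.
  have hae : (fun ω => Real.exp (min (T t ω 0) (T t ω 1) * G +
      (T t ω 0 - min (T t ω 0) (T t ω 1)) * A + (T t ω 1 - min (T t ω 0) (T t ω 1)) * B)) =ᵐ[P]
      fun ω => Real.exp (T t ω 0 * A + T t ω 1 * B) := by
    rcases le_total G (A + B) with hc | hc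
    · refine (integral_eq_iff_of_ae_le hi1 hi2 ?_).1 hmul
      filter_upwards [hnn] with ω hω
      refine Real.exp_le_exp.2 ?_
      nlinarith [mul_le_mul_of_nonneg_left hc (le_min (hω t 0) (hω t 1))]
    · refine ((integral_eq_iff_of_ae_le hi2 hi1 ?_).1 hmul.symm).symm
      filter_upwards [hnn] with ω hω
      refine Real.exp_le_exp.2 ?_
      nlinarith [mul_le_mul_of_nonneg_left hc (le_min (hω t 0) (hω t 1))]
  by_contra hne
  refine hpos ?_
  filter_upwards [hae] with ω hω
  have h1 := Real.exp_injective hω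
  have h2 : min (T t ω 0) (T t ω 1) * (G - (A + B)) = 0 := by linarith
  exact (mul_eq_zero.1 h2).resolve_right (sub_ne_zero.2 hne)

/-- For nontrivial independent components, both are positive with positive probability at some
positive time. -/
theorem IsSubordinator.exists_min_ne_zero (hT : IsSubordinator P T)
    (hind : ∀ t, IndepFun (fun ω => T t ω 0) (fun ω => T t ω 1) P)
    (hnt : ∀ k, IsNontrivial P (component T k)) :
    ∃ t : ℝ≥0, 0 < t ∧ ¬ ∀ᵐ ω ∂P, min (T t ω 0) (T t ω 1) = 0 := by
  have hex : ∀ k, ∃ n : ℕ, ¬ ∀ᵐ ω ∂P, T n ω k = 0 := by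
    intro k
    by_contra! hall
    refine hnt k ?_
    filter_upwards [ae_all_iff.2 hall, hT.ae_nonneg, hT.monotone] with ω h1 h2 h3 t
    obtain ⟨n, hn⟩ := exists_nat_ge t
    exact le_antisymm ((h3 k hn).trans (h1 n).le) (h2 t k)
  choose n hn using hex
  -- By monotonicity neither component is a.s. zero at this t; the 1 makes it positive.
  let t : ℝ≥0 := max (max (n 0) (n 1)) 1
  have ht : ∀ k, ¬ ∀ᵐ ω ∂P, T t ω k = 0 := by
    intro k h
    refine hn k ?_
    have hle : (n k : ℝ≥0) ≤ t := by
      fin_cases k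
      · exact (le_max_left _ _).trans (le_max_left _ _)
      · exact (le_max_right _ _).trans (le_max_left _ _)
    filter_upwards [h, hT.ae_nonneg, hT.monotone] with ω h1 h2 h3
    exact le_antisymm ((h3 k hle).trans h1.le) (h2 _ k)
  refine ⟨t, lt_of_lt_of_le one_pos (le_max_right _ _), fun hmin => ?_⟩
  have hprod := (hind t).measure_inter_preimage_eq_mul {x | x ≠ 0} {x | x ≠ 0}
    (measurableSet_singleton _).compl (measurableSet_singleton _).compl
  have hzero : P ((fun ω => T t ω 0) ⁻¹' {x | x ≠ 0} ∩ (fun ω => T t ω 1) ⁻¹' {x | x ≠ 0}) = 0 := by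
    refine measure_mono_null ?_ (ae_iff.1 hmin)
    intro ω ⟨h0, h1⟩ h
    rcases min_choice (T t ω 0) (T t ω 1) with h' | h'
    · exact h0 (h'.symm.trans h)
    · exact h1 (h'.symm.trans h)
  rw [hzero] at hprod
  rcases mul_eq_zero.1 hprod.symm with h | h
  · exact ht 0 (ae_iff.2 h)
  · exact ht 1 (ae_iff.2 h)

/-- If a symmetric Lévy process is subordinated by a drift-less subordinator with nontrivial
independent components, and the strong and weak subordinations have the same marginals, then the
components of the subordinate are independent processes. -/
theorem indepFun_component_of_identDistrib {Ω' Ω'' : Type*} [MeasurableSpace Ω']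
    [MeasurableSpace Ω''] {Q : Measure Ω'} {R : Measure Ω''} [IsProbabilityMeasure R]
    {Y : ℝ≥0 → Ω' → EuclideanSpace ℝ (Fin 2)}
    {Z : ℝ≥0 → Ω'' → EuclideanSpace ℝ (Fin 2 ⊕ Fin 2)}
    (hT : IsSubordinator P T) (hTX : IndepFun (path T) (path X) P)
    (hZ : IsWeakSubordination P T X R Z)
    (hYZ : IdentDistrib (path Y) (path (second Z)) Q R)
    (hsymm : IdentDistrib (path X) (path fun t ω => -X t ω) P P)
    (hind : IndepFun (path (component T 0)) (path (component T 1)) P)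
    (hdrift : ∀ k, IsDriftless P (scalar (component T k)))
    (hnt : ∀ k, IsNontrivial P (component T k))
    (hid : ∀ t : ℝ≥0, 0 < t → IdentDistrib (strongSub X T t) (Y t) P Q) :
    IndepFun (path (component X 0)) (path (component X 1)) P := by
  have hind_t : ∀ t, IndepFun (fun ω => T t ω 0) (fun ω => T t ω 1) P := fun t =>
    hind.comp (φ := fun f : ℝ≥0 → ℝ => f t) (ψ := fun f : ℝ≥0 → ℝ => f t) (by fun_prop)
      (by fun_prop)
  obtain ⟨d, ν, μ, S, ν', _, hX, _⟩ := id hZ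
  obtain ⟨g, hg⟩ := hX.exists_real_exponent hsymm
  obtain ⟨t, ht, hmin⟩ := hT.exists_min_ne_zero hind_t hnt
  have hlaw : P.map (strongSub X T t) = R.map (second Z t) :=
    (hid t ht).map_eq.trans (hYZ.comp (u := fun f : ℝ≥0 → EuclideanSpace ℝ (Fin 2) => f t)
      (measurable_pi_apply (X := fun _ : ℝ≥0 => EuclideanSpace ℝ (Fin 2)) t)).map_eq
  refine hX.levy.indepFun_component fun s => ?_
  rw [indepFun_iff_charFun_eq_mul (hX.levy.measurable s)]
  intro a b
  have hadd : g !₂[a, b] = g !₂[a, 0] + g !₂[0, b] := by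
    refine exponent_eq_add hT hX.levy hTX hg (hind_t t) hmin ?_
    rw [hlaw]
    exact hZ.charFun_second_eq_mul hind_t hdrift t a b
  rw [hg, hg, hg, hadd, ← Complex.ofReal_mul, ← Real.exp_add, mul_add]

end RealExponent

end WeakSubordination

end

/-! ### The proposition -/

theorem proposition3p10
    {Ω : Type*} [MeasurableSpace Ω] (P : Measure Ω) [IsProbabilityMeasure P]
    {Ω' : Type*} [MeasurableSpace Ω'] (Q : Measure Ω') [IsProbabilityMeasure Q]
    (T X : ℝ≥0 → Ω → EuclideanSpace ℝ (Fin 2))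
    (Y : ℝ≥0 → Ω' → EuclideanSpace ℝ (Fin 2))
    (hT : WeakSubordination.IsSubordinator P T)
    (hX : WeakSubordination.IsLevyProcess P X)
    (hY : WeakSubordination.IsLevyProcess Q Y)
    (hTX : IndepFun (WeakSubordination.path T) (WeakSubordination.path X) P)
    (hdep : ¬ IndepFun (WeakSubordination.path (WeakSubordination.component X 0))
      (WeakSubordination.path (WeakSubordination.component X 1)) P) :
    (MemLp (T 1) 2 P → MemLp (X 1) 2 P →
      cov[fun ω => X 1 ω 0, fun ω => X 1 ω 1; P] ≠ 0 →
      ¬ WeakSubordination.HasMonotonicComponents P T →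
      ∃ t : ℝ≥0, 0 < t ∧ ¬ IdentDistrib (WeakSubordination.strongSub X T t) (Y t) P Q) ∧
    (∀ {Ω'' : Type*} [MeasurableSpace Ω''] (R : Measure Ω'') [IsProbabilityMeasure R]
      (Z : ℝ≥0 → Ω'' → EuclideanSpace ℝ (Fin 2 ⊕ Fin 2)),
      WeakSubordination.IsWeakSubordination P T X R Z →
      IdentDistrib (WeakSubordination.path Y)
        (WeakSubordination.path (WeakSubordination.second Z)) Q R →
      IdentDistrib (WeakSubordination.path X)
        (WeakSubordination.path fun t ω => -X t ω) P P →
      IndepFun (WeakSubordination.path (WeakSubordination.component T 0))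
        (WeakSubordination.path (WeakSubordination.component T 1)) P →
      (∀ k, WeakSubordination.IsDriftless P
        (WeakSubordination.scalar (WeakSubordination.component T k))) →
      (∀ k, WeakSubordination.IsNontrivial P (WeakSubordination.component T k)) →
      ∃ t : ℝ≥0, 0 < t ∧ ¬ IdentDistrib (WeakSubordination.strongSub X T t) (Y t) P Q) := by
  refine ⟨fun hT1 hX1 hcov hmono => ?_, fun R _ Z hZ hYZ hsymm hind hdrift hnt => ?_⟩
  · by_contra! h
    exact hmono (WeakSubordination.hasMonotonicComponents_of_identDistrib hT hX hY hTX hT1 hX1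
      hcov h)
  · by_contra! h
    exact hdep (WeakSubordination.indepFun_component_of_identDistrib hT hTX hZ hYZ hsymm hind
      hdrift hnt h)
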